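/- Let $q\ge 7$ be a prime power. In $\mathrm{PG}(2,q)$ let $\mathcal K=\{(1,t,t^2):t\in\mathbb F_q\}\cup\{(0,0,1)\}$ be the conic. A bisecant of a point set is a line having exactly two points in common with it. Put $\mathfrak N_q=4$ for odd $q$ and $\mathfrak N_q=3$ for even $q$, and - for odd $q$: $\mathcal N_1=\frac12(q+1)$, $\mathbb B_1=\frac12(q-1)$; $\mathcal N_2=\frac12(q-1)(q+4)$, $\mathbb B_2=\frac12(q-3)$; $\mathcal N_3=\frac12(q-1)(q-3)$, $\mathbb B_3=\frac12(q-5)$; $\mathcal N_4=2$, $\mathbb B_4=0$; - for even $q$: $\mathcal N_1=3(q-1)$, $\mathbb B_1=\frac12(q-2)$; $\mathcal N_2=(q-1)(q-2)$, $\mathbb B_2=\frac12(q-4)$; $\mathcal N_3=3$, $\mathbb B_3=0$. **(A)** Let $P_1\ne P_2$ be points of $\mathcal K$ and $\mathcal K^{**}=\mathcal K\setminus\{P_1,P_2\}$. Then the $q^2+2$ points of $\mathrm{PG}(2,q)$ off $\mathcal K^{**}$ can be partitioned into $\mathfrak N_q$ classes $\mathcal A_1,\dots,\mathcal A_{\mathfrak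 N_q}$ with $\#\mathcal A_j=\mathcal N_j$ such that every point of $\mathcal A_j$ lies on exactly $\mathbb B_j$ bisecants of $\mathcal K^{**}$. **(B)** Let $H_4$ be the $3\times(q+1)$ matrix whose columns are $v_t(1,t,t^2)^{tr}$, $t\in\mathbb F_q$, and $v_\infty(0,0,1)^{tr}$, with arbitrary non-zero $v_t,v_\infty\in\mathbb F_q$. Let $H$ be obtained from $H_4$ by removing any two columns (the remaining columns being taken in any order), let $n=q-1$, let $\mathcal C$ be the linear code of length $n$ with parity check matrix $H$, and let $\mathcal K^{**}$ be $\mathcal K$ without the two points given by the removed columns. For a coset $\mathcal V$ of $\mathcal C$, let its weight be the smallest Hamming weight of its vectors, and let $B_w(\mathcal V)$ and $A_w(\mathcal C)$ be the numbers of vectors of weight $w$ in $\mathcal V$ and in $\mathcal C$. Put $\Omega_w^{(j)}=(-1)^{w-4}\binom{n-j}{w-j}\binom{w-1-j}{2-j}$. Then: 1. $\mathcal C$ is a $[q-1,q-4,4]_q$ code with covering radius $R=3$, and the columns of $H$ are homogeneous coordinates of the points of $\mathcal K^{**}$, each point occurring exactly once. 2. For each $1\le j\le\mathfrak N_q-1$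 there are exactly $(q-1)\mathcal N_j$ cosets $\mathcal V$ of weight $2$ with $B_2(\mathcal V)=\mathbb B_j$, and every coset of weight $2$ is of one of these kinds. Every coset $\mathcal V$ of weight $2$ has $B_0(\mathcal V)=B_1(\mathcal V)=0$ and, for $w=3,4,\dots,q-1$, $$B_w(\mathcal V)=A_w(\mathcal C)-\Omega_w^{(0)}+\Omega_w^{(2)}B_2(\mathcal V)=A_w(\mathcal C)-\Omega_w^{(0)}+(-1)^{w}\binom{q-3}{q-1-w}B_2(\mathcal V).$$ 3. There are exactly $(q-1)\mathcal N_{\mathfrak N_q}$ cosets of weight $3$, and every such coset $\mathcal V$ has $B_0(\mathcal V)=B_1(\mathcal V)=B_2(\mathcal V)=0$, $B_3(\mathcal V)=\binom{q-1}{3}$ and $$B_w(\mathcal V)=A_w(\mathcal C)-(-1)^w\binom{q-1}{w}\binom{w-1}{2},\qquad w=4,5,\dots,q+1.$$ -/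

import Mathlib

open scoped LinearAlgebra.Projectivization

section Plane

variable {F : Type*} [Field F]

/-- Homogeneous coordinates of the points of the conic `x₁² = x₀ x₂`, indexed by the projective
line `F ∪ {∞}` (with `none` in the role of `∞`): `t ↦ (1, t, t²)` and `∞ ↦ (0, 0, 1)`. -/
def conicVec : Option F → (Fin 3 → F)
  | some t => ![1, t, t ^ 2]
  | none => ![0, 0, 1]

theorem conicVec_ne_zero (s : Option F) : conicVec s ≠ 0 := by
  cases s with
  | none => intro h; simpa [conicVec] using congrFun h 2
  | some t => intro h; simpa [conicVec] using congrFun h 0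

/-- The point of `PG(2,q)` with homogeneous coordinates `conicVec s`. -/
def conicPoint (s : Option F) : ℙ F (Fin 3 → F) :=
  Projectivization.mk F (conicVec s) (conicVec_ne_zero s)

variable (F) in
/-- The conic `𝒦` in `PG(2,q)`. -/
def conic : Set (ℙ F (Fin 3 → F)) := Set.range conicPoint

/-- Lines of `PG(2,q)` are the two-dimensional subspaces of `F³`. A bisecant of a point set `S`
is a line that has exactly two common points with `S`. -/
def IsBisecant (S : Set (ℙ F (Fin 3 → F))) (L : Submodule F (Fin 3 → F)) : Prop :=
  Module.finrank F L = 2 ∧ {Q | Q ∈ S ∧ Q.submodule ≤ L}.ncard = 2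

/-- The number of bisecants of `S` on which the point `P` lies. -/
noncomputable def bisecantCount (S : Set (ℙ F (Fin 3 → F))) (P : ℙ F (Fin 3 → F)) : ℕ :=
  {L : Submodule F (Fin 3 → F) | IsBisecant S L ∧ P.submodule ≤ L}.ncard

/-- The parity check matrix `H₄` of the generalized doubly-extended Reed-Solomon code: its `q + 1`
columns, labelled by `F ∪ {∞}`, are `v_s (1, s, s²)ᵗʳ` for `s ∈ F` and `v_∞ (0, 0, 1)ᵗʳ`. -/
def matrixH4 (v : Option F → Fˣ) : Matrix (Fin 3) (Option F) F :=
  Matrix.of fun i s => conicVec s i * (v s : F)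

/-- The columns of the `3 × n` matrix `H` are homogeneous coordinates of the points of `S`,
each point of `S` being represented by exactly one column. -/
def ColumnsRepresent {n : ℕ} (H : Matrix (Fin 3) (Fin n) F) (S : Set (ℙ F (Fin 3 → F))) : Prop :=
  ∃ h : ∀ j, H.col j ≠ 0,
    Function.Injective (fun j => Projectivization.mk F (H.col j) (h j)) ∧
    Set.range (fun j => Projectivization.mk F (H.col j) (h j)) = S

end Plane

section Codes

variable {F : Type*} [Field F] [DecidableEq F] {n : ℕ}

/-- The linear code with parity check matrix `H`. -/
def codeOfParityCheck {m : ℕ} (H : Matrix (Fin m) (Fin n) F) : Submodule F (Fin n → F) :=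
  LinearMap.ker H.mulVecLin

/-- The minimum distance of a code. -/
noncomputable def minDistance (C : Submodule F (Fin n → F)) : ℕ :=
  sInf {d | ∃ x ∈ C, ∃ y ∈ C, x ≠ y ∧ hammingDist x y = d}

/-- The covering radius: the least `R` such that the balls of radius `R` about the codewords
cover the space. -/
noncomputable def coveringRadius (C : Submodule F (Fin n → F)) : ℕ :=
  sInf {R | ∀ x : Fin n → F, ∃ c ∈ C, hammingDist x c ≤ R}

/-- `A_w(C)`: the number of codewords of weight `w`. -/
noncomputable def codeWeightCount (C : Submodule F (Fin n → F)) (w : ℕ) : ℕ :=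
  {x | x ∈ C ∧ hammingNorm x = w}.ncard

/-- `B_w(V)`: the number of vectors of weight `w` in the coset `V` of `C`. -/
noncomputable def cosetWeightCount {C : Submodule F (Fin n → F)} (V : (Fin n → F) ⧸ C)
    (w : ℕ) : ℕ :=
  {x | C.mkQ x = V ∧ hammingNorm x = w}.ncard

/-- The weight of a coset: the smallest weight of a vector in it. -/
noncomputable def cosetWeight {C : Submodule F (Fin n → F)} (V : (Fin n → F) ⧸ C) : ℕ :=
  sInf {w | ∃ x, C.mkQ x = V ∧ hammingNorm x = w}

end Codes

/-- The coefficient `Ω_w^{(j)} = (-1)^{w-d} C(n-j, w-j) C(w-1-j, d-2-j)` of an `[n, k, d]` code,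
for `j ≤ min (w-1) (d-2)` and `w ≤ n`; the sign is written `(-1)^{w+d}`. -/
def omegaCoeff (n d w j : ℕ) : ℤ :=
  (-1) ^ (w + d) * ((n - j).choose (w - j) : ℤ) * ((w - 1 - j).choose (d - 2 - j) : ℤ)

/-- The number of classes of points off the double shortened conic. -/
def numClasses (q : ℕ) : ℕ := if Odd q then 4 else 3

/-- The sizes `𝒩_j` of the classes, `1 ≤ j ≤ numClasses q`. For `q ≥ 7` of the respective parity
all divisions are exact. -/
def classSize (q j : ℕ) : ℕ :=
  if Odd q then
    match j with
    | 1 => (q + 1) / 2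
    | 2 => (q - 1) * (q + 4) / 2
    | 3 => (q - 1) * (q - 3) / 2
    | 4 => 2
    | _ => 0
  else
    match j with
    | 1 => 3 * (q - 1)
    | 2 => (q - 1) * (q - 2)
    | 3 => 3
    | _ => 0

/-- The number `𝔹_j` of bisecants through a point of the `j`-th class, `1 ≤ j ≤ numClasses q`.
For `q ≥ 7` of the respective parity all divisions are exact. -/
def classBisecants (q j : ℕ) : ℕ :=
  if Odd q then
    match j with
    | 1 => (q - 1) / 2
    | 2 => (q - 3) / 2
    | 3 => (q - 5) / 2
    | _ => 0
  else
    match j with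
    | 1 => (q - 2) / 2
    | 2 => (q - 4) / 2
    | _ => 0

/-! Both halves rest on one count: for a nonzero vector `z` off the shortened conic, the number of
pairs of its points whose span contains `z` (`pairCount`). Geometry. A linear map moves the removed
points to (1,0,0) and (0,0,1), leaving the points (1,t,t²) with t ≠ 0. The chord through parameters
s ≠ t contains z exactly when z₀st − z₁(s+t) + z₂ = 0. If z₁² ≠ z₀z₂ this equation defines an
involution s ↦ (z₁s − z₂)/(z₀s − z₁) of the projective line, and bisecants through z are its
2-cycles avoiding 0 and ∞. Hence twice their number is q minus the number of s that are 0, are sent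
to 0 or ∞, or are fixed (`two_mul_pairCount_unitConicVec`). Fixed points correspond to tangents
through z: they are governed by the quadratic character of z₁² − z₀z₂ for odd q, and by the
bijectivity of squaring for even q. The classes record the possible outcomes and are counted as sets
of vectors; the factor q − 1 serves both the scalar multiples of a point and the syndromes of
cosets. Coding. Cosets correspond to syndromes z in F³. Since the columns form an arc, the number of
vectors of syndrome z supported in S does not depend on z once |S| ≥ 3, and is 1 or 0 when |S| ≤ 2,
according to whether z lies in the span. Möbius inversion over supports therefore expresses B_w −
A_w through `pairCount` alone (`IsArc.weightCount_of_three_le`). Cosets of weight 2 are those whose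
syndrome is off the arc but on a bisecant; cosets of weight 3 are those whose syndrome is off the
arc and on none. -/

/-! ### Inclusion-exclusion over subsets. -/

section Moebius

open Finset

variable {ι : Type*} [DecidableEq ι]

/-- Writing T as U together with a subset of S \ U leaves an alternating sum over a power set, which
cancels unless S \ U is empty. -/
theorem sum_neg_one_pow_card_superset (U S : Finset ι) (h : U ⊆ S) :
    ∑ T ∈ S.powerset with U ⊆ T, (-1 : ℤ) ^ (#S + #T) = if U = S then 1 else 0 := by
  have h1 : ∑ T ∈ S.powerset with U ⊆ T, (-1 : ℤ) ^ (#S + #T) =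
      ∑ T ∈ (S \ U).powerset, (-1 : ℤ) ^ (#S + #U) * (-1) ^ #T := by
    refine Finset.sum_bij' (fun T _ => T \ U) (fun T _ => T ∪ U) ?_ ?_ ?_ ?_ ?_
    · intro T hT
      simp only [mem_filter, mem_powerset] at hT ⊢
      exact sdiff_subset_sdiff hT.1 le_rfl
    · intro T hT
      simp only [mem_filter, mem_powerset] at hT ⊢
      exact ⟨union_subset (hT.trans sdiff_subset) h, subset_union_right⟩
    · intro T hT
      simp only [mem_filter, mem_powerset] at hT
      exact sdiff_union_of_subset hT.2
    · intro T hT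
      simp only [mem_powerset] at hT
      rw [union_sdiff_right]
      exact sdiff_eq_self_of_disjoint (disjoint_sdiff.symm.mono_left hT)
    · intro T hT
      simp only [mem_filter, mem_powerset] at hT
      have := card_sdiff_add_card_eq_card hT.2
      rw [← this, ← pow_add]
      exact congrArg _ (by ring)
  rw [h1, ← mul_sum, sum_powerset_neg_one_pow_card]
  by_cases hU : U = S
  · subst hU; simp [← two_mul]
  · have : S \ U ≠ ∅ := fun h' => hU (h.antisymm (sdiff_eq_empty_iff_subset.1 h'))
    simp [hU, this]

theorem moebius_powerset (f g : Finset ι → ℤ) (h : ∀ S, g S = ∑ T ∈ S.powerset, f T)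
    (S : Finset ι) : f S = ∑ T ∈ S.powerset, (-1) ^ (#S + #T) * g T := by
  have h1 : ∀ T ∈ S.powerset, (-1 : ℤ) ^ (#S + #T) * g T =
      ∑ U ∈ S.powerset, if U ⊆ T then (-1 : ℤ) ^ (#S + #T) * f U else 0 := by
    intro T hT
    rw [h, mul_sum, ← sum_filter]
    refine sum_congr ?_ fun _ _ => rfl
    ext U
    simp only [mem_powerset, mem_filter] at hT ⊢
    exact ⟨fun h => ⟨h.trans hT, h⟩, fun h => h.2⟩
  rw [sum_congr rfl h1, sum_comm]
  have h2 : ∀ U ∈ S.powerset,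
      (∑ T ∈ S.powerset, if U ⊆ T then (-1 : ℤ) ^ (#S + #T) * f U else 0) =
        if U = S then f U else 0 := by
    intro U hU
    rw [← sum_filter, ← sum_mul, sum_neg_one_pow_card_superset U S (mem_powerset.1 hU)]
    split_ifs <;> simp
  rw [sum_congr rfl h2, sum_ite_eq']
  simp

/-- Double counting: a fixed pair lies in C(n−2, w−2) sets of size w. -/
theorem sum_card_filter_powersetCard_two [Fintype ι] (p : Finset ι → Prop) [DecidablePred p]
    {w : ℕ} (hw : 2 ≤ w) :
    ∑ S ∈ (univ : Finset ι).powersetCard w, #{T ∈ S.powersetCard 2 | p T} =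
      (Fintype.card ι - 2).choose (w - 2) * #{T ∈ (univ : Finset ι).powersetCard 2 | p T} := by
  have h1 : ∀ S : Finset ι, {T ∈ S.powersetCard 2 | p T} =
      bipartiteAbove (fun S T => T ⊆ S) {T ∈ (univ : Finset ι).powersetCard 2 | p T} S := by
    intro S
    ext T
    simp only [mem_filter, mem_powersetCard, bipartiteAbove, subset_univ, true_and]
    tauto
  rw [sum_congr rfl fun S _ => congrArg card (h1 S),
    sum_card_bipartiteAbove_eq_sum_card_bipartiteBelow, mul_comm, ← smul_eq_mul]
  refine sum_eq_card_nsmul fun T hT => ?_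
  simp only [mem_filter, mem_powersetCard, subset_univ, true_and] at hT
  rw [bipartiteBelow, filter_powersetCard_subset T univ w (subset_univ T) (by omega),
    card_image_of_injOn, card_powersetCard, card_sdiff_of_subset (subset_univ T), hT.1, card_univ]
  intro A hA B hB hAB
  rw [mem_coe, mem_powersetCard] at hA hB
  have hd : ∀ A ⊆ univ \ T, (A ∪ T) \ T = A := fun A hA => by
    rw [union_sdiff_right]
    exact sdiff_eq_self_of_disjoint (disjoint_sdiff.symm.mono_left hA)
  rw [← hd A hA.1, ← hd B hB.1]
  exact congrArg (· \ T) hAB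

omit [DecidableEq ι] in
-- Only sizes 0, 1, 2 survive, and 1 − w + C(w,2) = C(w−1,2). This is the source of the binomial
-- coefficient in Ω_w^{(0)}.
theorem sum_truncated_neg_one_pow (S : Finset ι) (hS : 3 ≤ #S) :
    ∑ T ∈ S.powerset, (-1 : ℤ) ^ (#S + #T) * (if #T ≤ 2 then 1 else 0) =
      (-1) ^ #S * ((#S - 1).choose 2 : ℤ) := by
  rw [sum_powerset_apply_card (fun m => (-1 : ℤ) ^ (#S + m) * (if m ≤ 2 then 1 else 0))]
  have h1 : ∑ m ∈ range (#S + 1), (#S).choose m • ((-1 : ℤ) ^ (#S + m) *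
      (if m ≤ 2 then 1 else 0)) = ∑ m ∈ range 3, (#S).choose m • ((-1 : ℤ) ^ (#S + m) *
      (if m ≤ 2 then 1 else 0)) := by
    symm
    refine sum_subset (range_subset_range.2 (by omega)) fun m _ hm => ?_
    have : ¬ m ≤ 2 := by simp at hm; omega
    simp [this]
  rw [h1]
  obtain ⟨w, hw⟩ : ∃ w, #S = w + 1 := ⟨#S - 1, by omega⟩
  rw [hw, sum_range_succ, sum_range_succ, sum_range_one, Nat.choose_succ_succ' w 1]
  simp only [Nat.choose_zero_right, Nat.choose_one_right, pow_add, nsmul_eq_mul]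
  push_cast
  simp
  ring

end Moebius

/-! ### Vectors with a given syndrome over an arc, counted by support. -/

section Arc

open Finset

variable {F ι : Type*} [Field F] {h : ι → Fin 3 → F}

/-- The span of the vectors of the family `h` with index in `S`. -/
abbrev spanOn (h : ι → Fin 3 → F) (S : Finset ι) : Submodule F (Fin 3 → F) :=
  Submodule.span F (h '' (S : Set ι))

/-- A family of vectors of `F³` any three of which are linearly independent. -/
def IsArc (h : ι → Fin 3 → F) : Prop :=
  ∀ S : Finset ι, #S = 3 → LinearIndepOn F h (S : Set ι)

theorem IsArc.linearIndepOn [Fintype ι] (ha : IsArc h) (hι : 3 ≤ Fintype.card ι) {S : Finset ι}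
    (hS : #S ≤ 3) : LinearIndepOn F h (S : Set ι) := by
  obtain ⟨T, hST, hT⟩ := Finset.exists_superset_card_eq hS hι
  exact (ha T hT).mono (mod_cast hST)

theorem IsArc.span_eq_top (ha : IsArc h) {S : Finset ι} (hS : 3 ≤ #S) :
    spanOn h S = ⊤ := by
  obtain ⟨T, hTS, hT⟩ := Finset.exists_subset_card_eq hS
  have h1 := ha T hT
  have h2 : Submodule.span F (Set.range fun i : (T : Set ι) => h i) = ⊤ :=
    LinearIndependent.span_eq_top_of_card_eq_finrank' h1 (by simp [hT])
  rw [eq_top_iff, ← h2]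
  refine Submodule.span_mono ?_
  rintro _ ⟨i, rfl⟩
  exact ⟨i, hTS i.2, rfl⟩

variable [Fintype ι]

theorem mem_span_image_iff_exists_linearCombination (S : Finset ι) (z : Fin 3 → F) :
    z ∈ spanOn h S ↔
      ∃ x : ι → F, Fintype.linearCombination F h x = z ∧ ∀ i, x i ≠ 0 → i ∈ S := by
  classical
  rw [Submodule.mem_span_image_finset_iff_exists_fun']
  constructor
  · rintro ⟨c, hc⟩
    refine ⟨fun i => if i ∈ S then c i else 0, ?_, fun i => by aesop⟩
    rw [Fintype.linearCombination_apply, ← hc]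
    simp [ite_smul, Finset.sum_ite_mem]
  · rintro ⟨x, hx, hS⟩
    refine ⟨x, ?_⟩
    rw [← hx, Fintype.linearCombination_apply]
    refine Finset.sum_subset (subset_univ S) fun i _ hi => ?_
    rw [not_imp_comm.1 (hS i) hi, zero_smul]

theorem eq_of_linearCombination_eq {S : Finset ι} (hS : LinearIndepOn F h (S : Set ι))
    {x y : ι → F} (hx : ∀ i, x i ≠ 0 → i ∈ S) (hy : ∀ i, y i ≠ 0 → i ∈ S)
    (hxy : Fintype.linearCombination F h x = Fintype.linearCombination F h y) : x = y := by
  rw [linearIndepOn_finset_iff] at hS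
  have h0 : ∀ i, i ∉ S → (x - y) i = 0 := fun i hi => by
    simp [not_imp_comm.1 (hx i) hi, not_imp_comm.1 (hy i) hi]
  have h1 : ∑ i ∈ S, (x - y) i • h i = 0 := by
    rw [Finset.sum_subset (subset_univ S) fun i _ hi => by rw [h0 i hi, zero_smul],
      ← Fintype.linearCombination_apply, map_sub, hxy, sub_self]
  have h2 := hS (x - y) h1
  funext i
  by_cases hi : i ∈ S
  · exact sub_eq_zero.1 (h2 i hi)
  · exact sub_eq_zero.1 (h0 i hi)

variable [Fintype F] [DecidableEq F] [DecidableEq ι]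

/-- The number of vectors with syndrome `z` and support contained in `S`. -/
def supportedCount (h : ι → Fin 3 → F) (z : Fin 3 → F) (S : Finset ι) : ℕ :=
  #{x : ι → F | Fintype.linearCombination F h x = z ∧ ({i | x i ≠ 0} : Finset ι) ⊆ S}

/-- The number of vectors with syndrome `z` and support `S`. -/
def supportCount (h : ι → Fin 3 → F) (z : Fin 3 → F) (S : Finset ι) : ℕ :=
  #{x : ι → F | Fintype.linearCombination F h x = z ∧ ({i | x i ≠ 0} : Finset ι) = S}

/-- The number of vectors with syndrome `z` and weight `w`. -/
def weightCount (h : ι → Fin 3 → F) (z : Fin 3 → F) (w : ℕ) : ℕ :=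
  #{x : ι → F | Fintype.linearCombination F h x = z ∧ hammingNorm x = w}

open Classical in
/-- The number of pairs of vectors of the family whose span contains `z`. -/
noncomputable def pairCount (h : ι → Fin 3 → F) (z : Fin 3 → F) : ℕ :=
  #{T ∈ (univ : Finset ι).powersetCard 2 | z ∈ spanOn h T}

theorem supportedCount_eq_sum (z : Fin 3 → F) (S : Finset ι) :
    supportedCount h z S = ∑ T ∈ S.powerset, supportCount h z T := by
  unfold supportedCount supportCount
  rw [card_eq_sum_card_fiberwise (f := fun x => ({i | x i ≠ 0} : Finset ι)) (t := S.powerset)]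
  · refine sum_congr rfl fun T hT => congrArg card ?_
    ext x
    simp only [mem_filter, mem_univ, true_and, mem_powerset] at hT ⊢
    constructor
    · rintro ⟨⟨h1, -⟩, h2⟩; exact ⟨h1, h2⟩
    · rintro ⟨h1, h2⟩; exact ⟨⟨h1, h2 ▸ hT⟩, h2⟩
  · intro x hx
    rw [mem_coe, mem_filter] at hx
    exact mem_powerset.2 hx.2.2

theorem weightCount_eq_sum (z : Fin 3 → F) (w : ℕ) :
    weightCount h z w = ∑ S ∈ (univ : Finset ι).powersetCard w, supportCount h z S := by
  unfold weightCount supportCount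
  rw [card_eq_sum_card_fiberwise (f := fun x => ({i | x i ≠ 0} : Finset ι))
    (t := (univ : Finset ι).powersetCard w)]
  · refine sum_congr rfl fun T hT => congrArg card ?_
    ext x
    simp only [mem_filter, mem_univ, true_and, mem_powersetCard, subset_univ] at hT ⊢
    constructor
    · rintro ⟨⟨h1, -⟩, h2⟩; exact ⟨h1, h2⟩
    · rintro ⟨h1, h2⟩; exact ⟨⟨h1, by rw [hammingNorm, h2, hT]⟩, h2⟩
  · intro x hx
    rw [mem_coe, mem_filter] at hx
    exact mem_powersetCard.2 ⟨subset_univ _, hx.2.2⟩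

open Classical in
-- At most two vectors of an arc are independent, so a representation of z over S is unique if it
-- exists.
theorem IsArc.supportedCount_of_card_le_two (ha : IsArc h) (hι : 3 ≤ Fintype.card ι)
    (z : Fin 3 → F) {S : Finset ι} (hS : #S ≤ 2) :
    supportedCount h z S = if z ∈ spanOn h S then 1 else 0 := by
  have hsub : ∀ x : ι → F, ({i | x i ≠ 0} : Finset ι) ⊆ S ↔ ∀ i, x i ≠ 0 → i ∈ S := by
    intro x; simp [Finset.subset_iff]
  split_ifs with hz
  · rw [mem_span_image_iff_exists_linearCombination] at hz
    obtain ⟨x, hx, hxS⟩ := hz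
    refine card_eq_one.2 ⟨x, ?_⟩
    ext y
    simp only [mem_filter, mem_univ, true_and, mem_singleton, hsub]
    constructor
    · rintro ⟨h1, h2⟩
      exact eq_of_linearCombination_eq (ha.linearIndepOn hι (by omega)) h2 hxS (h1.trans hx.symm)
    · rintro rfl; exact ⟨hx, hxS⟩
  · rw [supportedCount, card_eq_zero, filter_eq_empty_iff]
    rintro x - ⟨h1, h2⟩
    exact hz ((mem_span_image_iff_exists_linearCombination S z).2 ⟨x, h1, (hsub x).1 h2⟩)

/-- The vectors indexed by S span F³, so some y supported in S has syndrome z, and translation by y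
matches the solutions for z with those for 0. -/
theorem IsArc.supportedCount_of_three_le_card (ha : IsArc h) (z : Fin 3 → F) {S : Finset ι}
    (hS : 3 ≤ #S) : supportedCount h z S = supportedCount h 0 S := by
  have hsub : ∀ x : ι → F, ({i | x i ≠ 0} : Finset ι) ⊆ S ↔ ∀ i, i ∉ S → x i = 0 := by
    intro x; simp [Finset.subset_iff, not_imp_comm]
  have hz : z ∈ spanOn h S := by rw [ha.span_eq_top hS]; trivial
  rw [mem_span_image_iff_exists_linearCombination] at hz
  obtain ⟨y, hy, hyS⟩ := hz
  have hyS' : ∀ i, i ∉ S → y i = 0 := fun i => not_imp_comm.1 (hyS i)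
  refine card_bij' (fun x _ => x - y) (fun x _ => x + y) ?_ ?_ ?_ ?_
  · intro x hx
    simp only [mem_filter, mem_univ, true_and, hsub] at hx ⊢
    exact ⟨by rw [map_sub, hx.1, hy, sub_self], fun i hi => by simp [hx.2 i hi, hyS' i hi]⟩
  · intro x hx
    simp only [mem_filter, mem_univ, true_and, hsub] at hx ⊢
    exact ⟨by rw [map_add, hx.1, hy, zero_add], fun i hi => by simp [hx.2 i hi, hyS' i hi]⟩
  · intro x _; simp
  · intro x _; simp

theorem IsArc.supportCount_eq_zero (ha : IsArc h) (hι : 3 ≤ Fintype.card ι) {z : Fin 3 → F}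
    {S T : Finset ι} (hST : T ⊆ S) (hS : #S ≤ 2)
    (hz : z ∉ spanOn h S) : supportCount h z T = 0 := by
  have h1 := ha.supportedCount_of_card_le_two hι z hS
  rw [if_neg hz, supportedCount_eq_sum] at h1
  exact Finset.sum_eq_zero_iff.1 h1 T (mem_powerset.2 hST)

open Classical in
/-- Vectors outside the span of every subfamily of at most one vector: the weight distribution of
the corresponding coset is determined by the number of pairs whose span contains the vector. -/
theorem IsArc.weightCount_two (ha : IsArc h) (hι : 3 ≤ Fintype.card ι) {z : Fin 3 → F}
    (hz : ∀ S : Finset ι, #S ≤ 1 → z ∉ spanOn h S) :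
    weightCount h z 2 = pairCount h z := by
  rw [weightCount_eq_sum, pairCount, card_filter]
  refine sum_congr rfl fun S hS => ?_
  have hS2 := (mem_powersetCard.1 hS).2
  rw [← ha.supportedCount_of_card_le_two hι z hS2.le, supportedCount_eq_sum]
  -- Proper subsets of a pair have at most one element, so by `hz` their spans miss z and they
  -- contribute nothing.
  refine (sum_eq_single_of_mem (f := supportCount h z) S (mem_powerset.2 subset_rfl) fun T hT hTS => ?_).symm
  have hT1 : #T ≤ 1 := by
    have := card_lt_card ((mem_powerset.1 hT).ssubset_of_ne hTS)
    omega
  exact ha.supportCount_eq_zero hι subset_rfl (by omega) (hz T hT1)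

/-- The supported counts for z and for 0 differ only on sets of size at most 2: there the count for
0 is 1, while the count for z is 1 only on the pairs counted by `pairCount`. Möbius inversion of
this difference, summed over all supports of size w, gives the two correction terms. -/
theorem IsArc.weightCount_of_three_le (ha : IsArc h) (hι : 3 ≤ Fintype.card ι) {z : Fin 3 → F}
    (hz : ∀ S : Finset ι, #S ≤ 1 → z ∉ spanOn h S) {w : ℕ}
    (hw : 3 ≤ w) :
    (weightCount h z w : ℤ) = weightCount h 0 w -
      (-1) ^ w * ((Fintype.card ι).choose w : ℤ) * ((w - 1).choose 2 : ℤ) +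
      (-1) ^ w * ((Fintype.card ι - 2).choose (w - 2) : ℤ) * pairCount h z := by
  classical
  have h1 : ∀ T : Finset ι, (supportedCount h z T : ℤ) - supportedCount h 0 T =
      (if T ∈ {T ∈ (univ : Finset ι).powersetCard 2 | z ∈ spanOn h T}
        then 1 else 0) - (if #T ≤ 2 then 1 else 0) := by
    intro T
    rcases le_or_gt #T 2 with hT | hT
    · rw [ha.supportedCount_of_card_le_two hι z hT, ha.supportedCount_of_card_le_two hι 0 hT]
      simp only [zero_mem, if_true, hT, mem_filter, mem_powersetCard, subset_univ, true_and]
      rcases hT.eq_or_lt with hT' | hT'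
      · simp [hT']
      · simp [hT'.ne, hz T (by omega)]
    · rw [ha.supportedCount_of_three_le_card z hT]
      have : ¬ #T ≤ 2 := by omega
      have h3 : #T ≠ 2 := by omega
      simp [this, mem_powersetCard, h3]
  have h2 : ∀ S : Finset ι, #S = w → (supportCount h z S : ℤ) - supportCount h 0 S =
      (-1) ^ w * (#{T ∈ S.powersetCard 2 | z ∈ spanOn h T} : ℤ) -
        (-1) ^ w * ((w - 1).choose 2 : ℤ) := by
    intro S hS
    have := moebius_powerset (fun S => (supportCount h z S : ℤ) - supportCount h 0 S)
      (fun S => (supportedCount h z S : ℤ) - supportedCount h 0 S)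
      (fun S => by simp [supportedCount_eq_sum]) S
    simp only [h1, mul_sub, sum_sub_distrib] at this
    rw [this, sum_truncated_neg_one_pow S (by omega), hS]
    congr 1
    simp only [mul_ite, mul_one, mul_zero]
    rw [← sum_filter]
    have h3 : {T ∈ S.powerset | T ∈ {T ∈ (univ : Finset ι).powersetCard 2 |
        z ∈ spanOn h T}} =
        {T ∈ S.powersetCard 2 | z ∈ spanOn h T} := by
      ext T
      simp only [mem_filter, mem_powerset, mem_powersetCard, subset_univ, true_and]
      tauto
    rw [h3, sum_congr rfl (g := fun _ => (-1 : ℤ) ^ w)]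
    · rw [sum_const, nsmul_eq_mul, mul_comm]
    · intro T hT
      rw [(mem_powersetCard.1 (mem_filter.1 hT).1).2, pow_add]
      simp
  have h3 : (weightCount h z w : ℤ) - weightCount h 0 w =
      ∑ S ∈ (univ : Finset ι).powersetCard w, ((-1) ^ w * (#{T ∈ S.powersetCard 2 |
        z ∈ spanOn h T} : ℤ) - (-1) ^ w * ((w - 1).choose 2 : ℤ)) := by
    rw [weightCount_eq_sum, weightCount_eq_sum]
    push_cast
    rw [← sum_sub_distrib]
    exact sum_congr rfl fun S hS => h2 S (mem_powersetCard.1 hS).2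
  rw [sum_sub_distrib, ← mul_sum, ← Nat.cast_sum,
    sum_card_filter_powersetCard_two _ (by omega : 2 ≤ w), sum_const, card_powersetCard,
    card_univ, nsmul_eq_mul] at h3
  have h4 : (#{T ∈ (univ : Finset ι).powersetCard 2 |
      z ∈ spanOn h T}) = pairCount h z := rfl
  rw [h4] at h3
  push_cast at h3
  linear_combination h3

end Arc

/-! ### Bisecants of an arc and pairs of its vectors. -/

section ArcPoints

open Finset

variable {F ι : Type*} [Field F] [Fintype ι] {h : ι → Fin 3 → F}

/-- Adjoining a new index to T gives at most three indices, still independent; so no further arc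
vector lies in the span. -/
theorem IsArc.mem_spanOn_iff (ha : IsArc h) (hι : 3 ≤ Fintype.card ι) {T : Finset ι}
    (hT : #T ≤ 2) (i : ι) : h i ∈ spanOn h T ↔ i ∈ T := by
  classical
  refine ⟨fun hi => ?_, fun hi => Submodule.subset_span ⟨i, hi, rfl⟩⟩
  by_contra hiT
  have h1 := ha.linearIndepOn hι (S := insert i T) (by rw [card_insert_of_notMem hiT]; omega)
  rw [coe_insert, linearIndepOn_insert (by simpa using hiT)] at h1
  exact h1.2 hi

theorem IsArc.ne_zero (ha : IsArc h) (hι : 3 ≤ Fintype.card ι) (i : ι) : h i ≠ 0 := by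
  intro h0
  have := (ha.mem_spanOn_iff hι (T := ∅) (by simp) i).1 (by rw [h0]; exact zero_mem _)
  simp at this

theorem IsArc.injective_mk (ha : IsArc h) (hι : 3 ≤ Fintype.card ι) (h0 : ∀ i, h i ≠ 0) :
    Function.Injective fun i => Projectivization.mk F (h i) (h0 i) := by
  intro i j hij
  obtain ⟨a, ha'⟩ := (Projectivization.mk_eq_mk_iff' F _ _ (h0 i) (h0 j)).1 hij
  have := (ha.mem_spanOn_iff hι (T := {j}) (by simp) i).1 (by
    rw [← ha']; exact Submodule.smul_mem _ _ (Submodule.subset_span ⟨j, by simp, rfl⟩))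
  simpa using this

omit [Fintype ι] in
theorem mk_mem_range_iff (h0 : ∀ i, h i ≠ 0) {z : Fin 3 → F} (hz : z ≠ 0) :
    Projectivization.mk F z hz ∈ (Set.range fun i => Projectivization.mk F (h i) (h0 i)) ↔
      ∃ i, z ∈ spanOn h {i} := by
  simp only [spanOn, Set.mem_range, coe_singleton, Set.image_singleton, Submodule.mem_span_singleton]
  refine exists_congr fun i => ?_
  rw [eq_comm, Projectivization.mk_eq_mk_iff']

/-- The bisecants of an arc through a point correspond to the pairs of points of the arc whose
span contains the point. -/
theorem IsArc.bisecantCount_eq (ha : IsArc h) (hι : 3 ≤ Fintype.card ι) (h0 : ∀ i, h i ≠ 0)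
    {z : Fin 3 → F} (hz : z ≠ 0) :
    bisecantCount (Set.range fun i => Projectivization.mk F (h i) (h0 i))
      (Projectivization.mk F z hz) = pairCount h z := by
  classical
  have h1 : ∀ L : Submodule F (Fin 3 → F),
      {Q | Q ∈ (Set.range fun i => Projectivization.mk F (h i) (h0 i)) ∧ Q.submodule ≤ L} =
        (fun i => Projectivization.mk F (h i) (h0 i)) ''
          (({i | h i ∈ L} : Finset ι) : Set ι) := by
    intro L
    ext Q
    simp only [Set.mem_ofPred_eq, Set.mem_range, Set.mem_image, coe_filter, mem_univ, true_and]
    constructor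
    · rintro ⟨⟨i, rfl⟩, hL⟩
      exact ⟨i, by simpa [Projectivization.submodule_mk] using hL, rfl⟩
    · rintro ⟨i, hi, rfl⟩
      exact ⟨⟨i, rfl⟩, by simpa [Projectivization.submodule_mk] using hi⟩
  have h2 : ∀ L, IsBisecant (Set.range fun i => Projectivization.mk F (h i) (h0 i)) L ↔
      Module.finrank F L = 2 ∧ #{i | h i ∈ L} = 2 := by
    intro L
    rw [IsBisecant, h1, Set.ncard_image_of_injective _ (ha.injective_mk hι h0),
      Set.ncard_coe_finset]
  have hspan : ∀ T : Finset ι, #T = 2 → Module.finrank F (spanOn h T) = 2 := by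
    intro T hT
    have h3 := ha.linearIndepOn hι (S := T) (by omega)
    have := finrank_span_eq_card (R := F) (b := fun i : (T : Set ι) => h i) h3
    rw [spanOn, Set.image_eq_range, this]
    simp [hT]
  -- A bisecant meets the arc only in the two points spanning it, so the pair is recovered from the
  -- line; this gives injectivity below.
  have hrec : ∀ T : Finset ι, #T = 2 → ({i | h i ∈ spanOn h T} : Finset ι) = T := by
    intro T hT
    ext i
    simp [ha.mem_spanOn_iff hι hT.le]
  have h3 : {L | IsBisecant (Set.range fun i => Projectivization.mk F (h i) (h0 i)) L ∧
      (Projectivization.mk F z hz).submodule ≤ L} = spanOn h ''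
        (({T ∈ (univ : Finset ι).powersetCard 2 | z ∈ spanOn h T} : Finset (Finset ι)) :
          Set (Finset ι)) := by
    ext L
    simp only [Set.mem_ofPred_eq, h2, Projectivization.submodule_mk,
      Submodule.span_singleton_le_iff_mem, Set.mem_image, coe_filter, mem_powersetCard,
      subset_univ, true_and]
    constructor
    · rintro ⟨⟨hL, hT⟩, hzL⟩
      have : spanOn h ({i | h i ∈ L} : Finset ι) = L := by
        refine Submodule.eq_of_le_of_finrank_eq ?_ (by rw [hspan _ hT, hL])
        rw [Submodule.span_le]
        rintro _ ⟨i, hi, rfl⟩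
        simpa using hi
      exact ⟨_, ⟨hT, this.symm ▸ hzL⟩, this⟩
    · rintro ⟨T, ⟨hT, hzT⟩, rfl⟩
      exact ⟨⟨hspan T hT, by rw [hrec T hT, hT]⟩, hzT⟩
  rw [bisecantCount, h3, Set.InjOn.ncard_image, Set.ncard_coe_finset, pairCount]
  intro T hT T' hT' hTT'
  simp only [coe_filter, mem_powersetCard, subset_univ, true_and, Set.mem_ofPred_eq] at hT hT'
  rw [← hrec T hT.1, ← hrec T' hT'.1, hTT']

end ArcPoints

/-! ### Chords of the normalized conic and their involution. -/

section CanonicalArc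

open Finset

variable {F : Type*} [Field F]

/-- The conic without the points `(1, 0, 0)` and `(0, 0, 1)`. -/
def unitConicVec (t : Fˣ) : Fin 3 → F := ![1, t, (t : F) ^ 2]

theorem mem_spanOn_unitConicVec_singleton (z : Fin 3 → F) :
    (∃ t, z ∈ spanOn unitConicVec {t}) ↔
      z = 0 ∨ (z 0 ≠ 0 ∧ z 1 ≠ 0 ∧ z 1 ^ 2 = z 0 * z 2) := by
  simp only [spanOn, coe_singleton, Set.image_singleton, Submodule.mem_span_singleton]
  constructor
  · rintro ⟨t, a, rfl⟩
    by_cases ha : a = 0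
    · left; simp [ha]
    · right
      simp [unitConicVec, ha]
      ring
  · rintro (rfl | ⟨h0, h1, h⟩)
    · exact ⟨1, 0, by simp⟩
    · refine ⟨Units.mk0 (z 1 / z 0) (div_ne_zero h1 h0), z 0, ?_⟩
      ext i
      fin_cases i
      · simp [unitConicVec]
      · simp [unitConicVec]; field_simp
      · simp [unitConicVec]; field_simp; exact h

theorem mem_spanOn_unitConicVec_pair [DecidableEq F] (z : Fin 3 → F) {s t : Fˣ} (hst : s ≠ t) :
    z ∈ spanOn unitConicVec {s, t} ↔ z 0 * s * t - z 1 * (s + t) + z 2 = 0 := by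
  simp only [spanOn, coe_insert, coe_singleton, Set.image_insert_eq, Set.image_singleton,
    Submodule.mem_span_pair]
  constructor
  · rintro ⟨x, y, rfl⟩
    simp [unitConicVec]
    ring
  · intro h
    have hne : (s : F) - t ≠ 0 := sub_ne_zero.2 fun h => hst (Units.ext h)
    -- Cramer's rule on the first two coordinates; the chord equation is what the third coordinate
    -- requires.
    refine ⟨(z 1 - z 0 * t) / (s - t), (z 0 * s - z 1) / (s - t), ?_⟩
    ext i
    fin_cases i
    · simp [unitConicVec]; field_simp; ring
    · simp [unitConicVec]; field_simp; ring
    · simp [unitConicVec]; field_simp; linear_combination (-(s : F) + t) * h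

theorem two_mul_pairCount {ι : Type*} [Fintype ι] [DecidableEq ι] (h : ι → Fin 3 → F)
    (z : Fin 3 → F) (r : ι → ι → Prop) [∀ i j, Decidable (r i j)]
    (hr : ∀ i j, i ≠ j → (z ∈ spanOn h {i, j} ↔ r i j)) :
    2 * pairCount h z = #{p : ι × ι | p.1 ≠ p.2 ∧ r p.1 p.2} := by
  classical
  rw [pairCount, card_eq_sum_card_fiberwise (f := fun p : ι × ι => ({p.1, p.2} : Finset ι))
    (t := {T ∈ (univ : Finset ι).powersetCard 2 | z ∈ spanOn h T}), mul_comm, ← smul_eq_mul]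
  · refine (sum_eq_card_nsmul fun T hT => ?_).symm
    simp only [mem_filter, mem_powersetCard, subset_univ, true_and] at hT
    obtain ⟨i, j, hij, rfl⟩ := card_eq_two.1 hT.1
    have hz := hT.2
    have hz' : z ∈ spanOn h {j, i} := by rwa [pair_comm]
    have : ({p ∈ {p : ι × ι | p.1 ≠ p.2 ∧ r p.1 p.2} | ({p.1, p.2} : Finset ι) = {i, j}} :
        Finset (ι × ι)) = {(i, j), (j, i)} := by
      ext ⟨k, l⟩
      simp only [mem_filter, mem_univ, true_and, mem_insert, mem_singleton, Prod.mk.injEq]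
      constructor
      · rintro ⟨⟨hkl, -⟩, hT⟩
        have hk : k ∈ ({i, j} : Finset ι) := hT ▸ mem_insert_self _ _
        have hl : l ∈ ({i, j} : Finset ι) := hT ▸ (by simp)
        simp only [mem_insert, mem_singleton] at hk hl
        rcases hk with rfl | rfl <;> rcases hl with rfl | rfl <;> simp_all
      · rintro (⟨rfl, rfl⟩ | ⟨rfl, rfl⟩)
        · exact ⟨⟨hij, (hr _ _ hij).1 hz⟩, rfl⟩
        · exact ⟨⟨hij.symm, (hr _ _ hij.symm).1 hz'⟩, pair_comm _ _⟩
    rw [this, card_pair]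
    simp [hij]
  · rintro ⟨i, j⟩ hp
    rw [mem_coe, mem_filter] at hp
    rw [mem_coe, mem_filter, mem_powersetCard]
    exact ⟨⟨subset_univ _, card_pair hp.2.1⟩, (hr _ _ hp.2.1).2 hp.2.2⟩

variable [Fintype F] [DecidableEq F]

theorem pairCount_unitConicVec_eq_zero {z : Fin 3 → F}
    (hz : ∀ s t : Fˣ, s ≠ t → z 0 * s * t - z 1 * (s + t) + z 2 ≠ 0) :
    pairCount unitConicVec z = 0 := by
  have := two_mul_pairCount unitConicVec z _ fun i j => mem_spanOn_unitConicVec_pair z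
  rw [filter_false_of_mem, card_empty] at this
  · omega
  · rintro ⟨s, t⟩ - ⟨h1, h2⟩
    exact hz s t h1 h2

/-- The chord equation determines the partner of s as (z₁s − z₂)/(z₀s − z₁), an involution of the
projective line because z₁² ≠ z₀z₂. Ordered pairs thus correspond to parameters s that are nonzero,
whose partner is neither ∞ (z₀s = z₁) nor 0 (z₁s = z₂), and which are not fixed (the quadratic). -/
theorem two_mul_pairCount_unitConicVec {z : Fin 3 → F} (hz : z 1 ^ 2 ≠ z 0 * z 2) :
    2 * pairCount unitConicVec z + #{s : F | s = 0 ∨ z 0 * s = z 1 ∨ z 1 * s = z 2 ∨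
      z 0 * s ^ 2 - 2 * z 1 * s + z 2 = 0} = Fintype.card F := by
  have h1 := two_mul_pairCount unitConicVec z _ fun i j => mem_spanOn_unitConicVec_pair z
  have h2 : #{p : Fˣ × Fˣ | p.1 ≠ p.2 ∧ z 0 * p.1 * p.2 - z 1 * (p.1 + p.2) + z 2 = 0} =
      #{s : F | ¬ (s = 0 ∨ z 0 * s = z 1 ∨ z 1 * s = z 2 ∨
        z 0 * s ^ 2 - 2 * z 1 * s + z 2 = 0)} := by
    refine card_bij (fun p _ => (p.1 : F)) ?_ ?_ ?_
    · rintro ⟨s, t⟩ hp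
      simp only [mem_filter, mem_univ, true_and, not_or] at hp ⊢
      obtain ⟨hne, h⟩ := hp
      have hst : (s : F) - t ≠ 0 := sub_ne_zero.2 fun h => hne (Units.ext h)
      -- If z₀s = z₁, the chord equation loses t and becomes z₁s = z₂; together these give z₁² =
      -- z₀z₂.
      have h3 : z 0 * s ≠ z 1 := by
        intro h3
        apply hz
        have : z 1 * s = z 2 := by linear_combination (t : F) * h3 - h
        linear_combination -z 1 * h3 + z 0 * this
      refine ⟨s.ne_zero, h3, ?_, ?_⟩
      · intro h4
        have : (t : F) * (z 0 * s - z 1) = 0 := by linear_combination h + h4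
        rcases mul_eq_zero.1 this with h5 | h5
        · exact t.ne_zero h5
        · exact h3 (sub_eq_zero.1 h5)
      · intro h4
        have : ((s : F) - t) * (z 0 * s - z 1) = 0 := by linear_combination h4 - h
        rcases mul_eq_zero.1 this with h5 | h5
        · exact hst h5
        · exact h3 (sub_eq_zero.1 h5)
    · rintro ⟨s, t⟩ hp ⟨s', t'⟩ hp' hss
      obtain rfl : s = s' := Units.ext hss
      simp only [mem_filter, mem_univ, true_and] at hp hp'
      have h3 : z 0 * s ≠ z 1 := by
        intro h3
        apply hz
        have : z 1 * s = z 2 := by linear_combination (t : F) * h3 - hp.2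
        linear_combination -z 1 * h3 + z 0 * this
      have h4 : ((t : F) - t') * (z 0 * s - z 1) = 0 := by linear_combination hp.2 - hp'.2
      rcases mul_eq_zero.1 h4 with h5 | h5
      · rw [Units.ext (sub_eq_zero.1 h5)]
      · exact absurd (sub_eq_zero.1 h5) h3
    · intro s hs
      simp only [mem_filter, mem_univ, true_and, not_or] at hs
      obtain ⟨h0, h3, h4, h5⟩ := hs
      have h3' : z 0 * s - z 1 ≠ 0 := sub_ne_zero.2 h3
      have h4' : z 1 * s - z 2 ≠ 0 := sub_ne_zero.2 h4
      refine ⟨(Units.mk0 s h0, Units.mk0 _ (div_ne_zero h4' h3')), ?_, rfl⟩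
      simp only [mem_filter, mem_univ, true_and, Units.val_mk0]
      constructor
      · intro h
        have h6 : s = (z 1 * s - z 2) / (z 0 * s - z 1) := congrArg Units.val h
        rw [eq_div_iff h3'] at h6
        exact h5 (by linear_combination h6)
      · field_simp
        ring
  rw [h1, h2, add_comm, card_filter_add_card_filter_not, card_univ]

end CanonicalArc

/-! ### Counting tools: zero patterns, quadratic character, exceptional parameters. -/

section ClassCounts

open Finset

variable {F : Type*} [Field F] [Fintype F] [DecidableEq F]

/-- All class conditions are such that the number of admissible last coordinates depends only on
which of the first two vanish. -/
theorem card_filter_of_zero_pattern (p : F → F → F → Prop) [∀ a b c, Decidable (p a b c)]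
    {n₀₀ n₀₁ n₁₀ n₁₁ : ℕ} (h₀₀ : #{c | p 0 0 c} = n₀₀) (h₀₁ : ∀ b ≠ 0, #{c | p 0 b c} = n₀₁)
    (h₁₀ : ∀ a ≠ 0, #{c | p a 0 c} = n₁₀) (h₁₁ : ∀ a ≠ 0, ∀ b ≠ 0, #{c | p a b c} = n₁₁) :
    #{z : Fin 3 → F | p (z 0) (z 1) (z 2)} = n₀₀ + (Fintype.card F - 1) * n₀₁ +
      (Fintype.card F - 1) * n₁₀ + (Fintype.card F - 1) ^ 2 * n₁₁ := by
  have h1 : #{z : Fin 3 → F | p (z 0) (z 1) (z 2)} = ∑ a, ∑ b, #{c | p a b c} := by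
    rw [card_eq_sum_card_fiberwise (f := fun z => (z 0, z 1)) (t := univ) (by simp [Set.MapsTo]),
      ← Fintype.sum_prod_type' (f := fun a b => #{c | p a b c})]
    refine sum_congr rfl fun ab _ => ?_
    refine card_bij (fun z _ => z 2) ?_ ?_ ?_
    · intro z hz
      simp only [mem_filter, mem_univ, true_and] at hz ⊢
      rw [← hz.2]; exact hz.1
    · intro z hz z' hz' h2
      simp only [mem_filter, mem_univ, true_and] at hz hz'
      have h3 := hz.2.trans hz'.2.symm
      simp only [Prod.mk.injEq] at h3
      ext i
      fin_cases i
      exacts [h3.1, h3.2, h2]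
    · intro c hc
      refine ⟨![ab.1, ab.2, c], ?_, by simp⟩
      simpa using hc
  have hc : #({0}ᶜ : Finset F) = Fintype.card F - 1 := by rw [card_compl, card_singleton]
  have h2 : ∀ a : F, a ≠ 0 → ∑ b, #{c | p a b c} = n₁₀ + (Fintype.card F - 1) * n₁₁ := by
    intro a ha
    rw [Fintype.sum_eq_add_sum_compl 0, h₁₀ a ha, sum_congr rfl (g := fun _ => n₁₁), sum_const,
      hc, smul_eq_mul]
    intro b hb
    exact h₁₁ a ha b (by simpa using hb)
  rw [h1, Fintype.sum_eq_add_sum_compl 0, sum_congr rfl (s₁ := {0}ᶜ)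
    (g := fun _ => n₁₀ + (Fintype.card F - 1) * n₁₁), sum_const, hc, smul_eq_mul,
    Fintype.sum_eq_add_sum_compl 0, h₀₀, sum_congr rfl (g := fun _ => n₀₁), sum_const, hc,
    smul_eq_mul]
  · ring
  · intro b hb
    exact h₀₁ b (by simpa using hb)
  · intro a ha
    exact h2 a (by simpa using ha)

omit [DecidableEq F] in
theorem card_filter_sub_mul {a : F} (ha : a ≠ 0) (d : F) (P : F → Prop) [DecidablePred P] :
    #{c | P (d - a * c)} = #{u | P u} := by
  refine card_bij (fun c _ => d - a * c) ?_ ?_ ?_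
  · intro c hc; simpa using hc
  · intro c _ c' _ h
    exact mul_left_cancel₀ ha (sub_right_injective h)
  · intro u hu
    have : d - a * ((d - u) / a) = u := by field_simp; ring
    exact ⟨(d - u) / a, by simpa [this] using hu, this⟩

/-- The character takes the values ±1 off 0 and sums to zero, so both values occur equally often. -/
theorem card_quadraticChar_eq (hF : ringChar F ≠ 2) :
    2 * #{u : F | quadraticChar F u = 1} + 1 = Fintype.card F ∧
      2 * #{u : F | quadraticChar F u = -1} + 1 = Fintype.card F := by
  have h1 : ∀ u : F, quadraticChar F u =
      (if quadraticChar F u = 1 then 1 else 0) - (if quadraticChar F u = -1 then 1 else 0) := by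
    intro u
    by_cases hu : u = 0
    · simp [hu]
    · rcases quadraticChar_dichotomy hu with h | h <;> simp [h]
  have h2 := quadraticChar_sum_zero hF
  rw [sum_congr rfl fun u _ => h1 u, sum_sub_distrib, sum_boole, sum_boole] at h2
  have h3 : ∀ u : F, 1 = (if quadraticChar F u = 1 then 1 else 0) +
      (if quadraticChar F u = -1 then 1 else 0) + (if u = 0 then 1 else 0) := by
    intro u
    by_cases hu : u = 0
    · simp [hu]
    · rcases quadraticChar_dichotomy hu with h | h <;> simp [h, hu]
  have h4 : Fintype.card F = ∑ u : F, 1 := by simp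
  rw [sum_congr rfl fun u _ => h3 u, sum_add_distrib, sum_add_distrib, ← card_filter,
    ← card_filter, ← card_filter] at h4
  have h5 : #{u : F | u = 0} = 1 := by simp [filter_eq']
  omega

/-- Completing the square: s ↦ as − b carries the roots to the square roots of b² − ac. -/
theorem card_quadratic_roots (hF : ringChar F ≠ 2) {a : F} (ha : a ≠ 0) (b c : F) :
    (#{s : F | a * s ^ 2 - 2 * b * s + c = 0} : ℤ) = quadraticChar F (b ^ 2 - a * c) + 1 := by
  rw [← quadraticChar_card_sqrts hF, Nat.cast_inj]
  refine card_bij (fun s _ => a * s - b) ?_ ?_ ?_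
  · intro s hs
    simp only [mem_filter, mem_univ, true_and, Set.mem_toFinset, Set.mem_ofPred_eq] at hs ⊢
    linear_combination a * hs
  · intro s _ s' _ h
    exact mul_left_cancel₀ ha (sub_left_injective h)
  · intro x hx
    simp only [Set.mem_toFinset, Set.mem_ofPred_eq] at hx
    refine ⟨(x + b) / a, ?_, by field_simp; ring⟩
    simp only [mem_filter, mem_univ, true_and]
    field_simp
    linear_combination hx

/-- In general position 0, b/a, c/b and the fixed points are all different: a coincidence among b/a,
c/b and the fixed points would force b² = ac, and one with 0 would force b = 0 or c = 0. -/
theorem card_exceptional {a b c : F} (ha : a ≠ 0) (hb : b ≠ 0) (hc : c ≠ 0)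
    (hbac : b ^ 2 ≠ a * c) :
    #{s : F | s = 0 ∨ a * s = b ∨ b * s = c ∨ a * s ^ 2 - 2 * b * s + c = 0} =
      #{s : F | a * s ^ 2 - 2 * b * s + c = 0} + 3 := by
  have hd : b ^ 2 - a * c ≠ 0 := sub_ne_zero.2 hbac
  have : ({s : F | s = 0 ∨ a * s = b ∨ b * s = c ∨ a * s ^ 2 - 2 * b * s + c = 0} :
      Finset F) = insert 0 (insert (b / a) (insert (c / b)
        ({s | a * s ^ 2 - 2 * b * s + c = 0} : Finset F))) := by
    ext s
    have h3 : a * s = b ↔ s = b / a := by rw [eq_div_iff ha, mul_comm]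
    have h4 : b * s = c ↔ s = c / b := by rw [eq_div_iff hb, mul_comm]
    simp [h3, h4]
  have n1 : c / b ∉ ({s | a * s ^ 2 - 2 * b * s + c = 0} : Finset F) := by
    simp only [mem_filter, mem_univ, true_and]
    intro h
    field_simp at h
    have : c * (b ^ 2 - a * c) = 0 := by linear_combination -h
    exact mul_ne_zero hc hd this
  have n2 : b / a ∉ insert (c / b) ({s | a * s ^ 2 - 2 * b * s + c = 0} : Finset F) := by
    simp only [mem_insert, mem_filter, mem_univ, true_and, not_or]
    constructor
    · rw [div_eq_div_iff ha hb]
      intro h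
      exact hbac (by linear_combination h)
    · intro h
      field_simp at h
      exact hd (by linear_combination -h)
  have n3 : (0 : F) ∉ insert (b / a) (insert (c / b)
      ({s | a * s ^ 2 - 2 * b * s + c = 0} : Finset F)) := by
    simp [ha, hb, hc, Ne.symm]
  rw [this, card_insert_of_notMem n3, card_insert_of_notMem n2,
    card_insert_of_notMem n1] 

theorem classBisecants_odd {q : ℕ} (hq : Odd q) : classBisecants q 1 = (q - 1) / 2 ∧
    classBisecants q 2 = (q - 3) / 2 ∧ classBisecants q 3 = (q - 5) / 2 ∧
    classBisecants q 4 = 0 :=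
  ⟨if_pos hq, if_pos hq, if_pos hq, if_pos hq⟩

theorem classBisecants_even {q : ℕ} (hq : ¬ Odd q) : classBisecants q 1 = (q - 2) / 2 ∧
    classBisecants q 2 = (q - 4) / 2 ∧ classBisecants q 3 = 0 :=
  ⟨if_neg hq, if_neg hq, if_neg hq⟩

theorem classSize_odd {q : ℕ} (hq : Odd q) : classSize q 1 = (q + 1) / 2 ∧
    classSize q 2 = (q - 1) * (q + 4) / 2 ∧ classSize q 3 = (q - 1) * (q - 3) / 2 ∧
    classSize q 4 = 2 :=
  ⟨if_pos hq, if_pos hq, if_pos hq, if_pos hq⟩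

theorem classSize_even {q : ℕ} (hq : ¬ Odd q) : classSize q 1 = 3 * (q - 1) ∧
    classSize q 2 = (q - 1) * (q - 2) ∧ classSize q 3 = 3 :=
  ⟨if_neg hq, if_neg hq, if_neg hq⟩

end ClassCounts

/-! ### Classes for odd q. -/

section OddOrder

open Finset

variable {F : Type*} [Field F] [Fintype F] [DecidableEq F]

/-- The class of a vector for odd `q`; class `0` consists of the zero vector and of the vectors
on the conic with non-zero coordinates. -/
def oddClass (a b c : F) : ℕ :=
  if a = 0 then
    if b = 0 then (if c = 0 then 0 else 4) else (if c = 0 then 1 else 2)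
  else if b = 0 then
    if c = 0 then 4 else if quadraticChar F (0 - a * c) = -1 then 1 else 2
  else if c = 0 then 2
  else if b ^ 2 = a * c then 0
  else if quadraticChar F (b ^ 2 - a * c) = 1 then 3 else 2

theorem oddClass_le (a b c : F) : oddClass a b c ≤ 4 := by
  unfold oddClass; split_ifs <;> omega

theorem oddClass_eq_zero_iff (z : Fin 3 → F) :
    oddClass (z 0) (z 1) (z 2) = 0 ↔ ∃ t, z ∈ spanOn unitConicVec {t} := by
  rw [mem_spanOn_unitConicVec_singleton]
  have h0 : z = 0 ↔ z 0 = 0 ∧ z 1 = 0 ∧ z 2 = 0 := by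
    simp [funext_iff, Fin.forall_fin_succ]
  rw [h0]
  generalize z 0 = a, z 1 = b, z 2 = c
  unfold oddClass
  split_ifs <;> simp_all

/-- Classes 1, 2, 3 have 1, 3, 5 exceptional parameters. Class 1 is the pole (0,1,0) of the removed
chord together with the internal points of that chord. Class 2 consists of the external points of
the chord, the remaining points of the tangents at the removed points, and the other internal
points. Class 3 contains the other external points. The removed points form class 4, where the chord
equation has no solution. -/
theorem pairCount_of_oddClass (hF : Odd (Fintype.card F)) (hq : 7 ≤ Fintype.card F)
    (z : Fin 3 → F) (hz : oddClass (z 0) (z 1) (z 2) ≠ 0) :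
    pairCount unitConicVec z =
      classBisecants (Fintype.card F) (oddClass (z 0) (z 1) (z 2)) := by
  have hchar : ringChar F ≠ 2 := fun h => by
    have := FiniteField.even_card_iff_char_two.1 h
    rw [Nat.odd_iff] at hF; omega
  obtain ⟨b1, b2, b3, b4⟩ := classBisecants_odd hF
  have h2 : (2 : F) ≠ 0 := Ring.two_ne_zero hchar
  obtain ⟨m, hm⟩ := id hF
  have key := two_mul_pairCount_unitConicVec (z := z)
  have key0 := pairCount_unitConicVec_eq_zero (z := z)
  generalize pairCount unitConicVec z = n at *
  generalize z 0 = a, z 1 = b, z 2 = c at *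
  unfold oddClass at hz ⊢
  by_cases ha : a = 0
  · subst ha
    by_cases hb : b = 0
    · subst hb
      by_cases hc : c = 0
      · simp [hc] at hz
      · simp only [hc, if_true, if_false]
        rw [key0 fun s t _ => by simpa using hc]
        simp [b4]
    · replace key := key (by simpa using hb)
      by_cases hc : c = 0
      · subst hc
        have : ({s : F | s = 0 ∨ 0 * s = b ∨ b * s = 0 ∨ 0 * s ^ 2 - 2 * b * s + 0 = 0} :
            Finset F) = {0} := by
          ext s; simp [hb, h2, Ne.symm hb]
        rw [this, card_singleton] at key
        simp only [hb, if_true, if_false, b1]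
        omega
      · have : ({s : F | s = 0 ∨ 0 * s = b ∨ b * s = c ∨ 0 * s ^ 2 - 2 * b * s + c = 0} :
            Finset F) = {0, c / b, c / (2 * b)} := by
          ext s
          have h3 : b * s = c ↔ s = c / b := by rw [eq_div_iff hb, mul_comm]
          have h4 : 0 * s ^ 2 - 2 * b * s + c = 0 ↔ s = c / (2 * b) := by
            rw [eq_div_iff (mul_ne_zero h2 hb)]
            constructor <;> intro h <;> linear_combination -h
          have h5 : 0 * s = b ↔ False := by simp [Ne.symm hb]
          simp only [mem_filter, mem_univ, true_and, mem_insert, mem_singleton]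
          rw [h3, h4, h5, false_or]
        rw [this, card_eq_three.2 ⟨0, c / b, c / (2 * b), (div_ne_zero hc hb).symm,
          (div_ne_zero hc (mul_ne_zero h2 hb)).symm, ?_, rfl⟩] at key
        · simp only [hb, hc, if_true, if_false, b2]
          omega
        · intro h
          field_simp at h
          have : (1 : F) = 0 := by linear_combination h
          exact one_ne_zero this
  · by_cases hb : b = 0
    · subst hb
      by_cases hc : c = 0
      · simp only [hc, if_true]
        rw [key0 (by intro s t _; simp [ha, hc])]
        simp [b4, ha]
      · have hac : a * c ≠ 0 := mul_ne_zero ha hc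
        replace key := key (by simpa using ⟨ha, hc⟩)
        have : ({s : F | s = 0 ∨ a * s = 0 ∨ 0 * s = c ∨ a * s ^ 2 - 2 * 0 * s + c = 0} :
            Finset F) = insert 0 ({s | a * s ^ 2 - 2 * 0 * s + c = 0} : Finset F) := by
          ext s; simp [ha, Ne.symm hc]
        rw [this, card_insert_of_notMem (by simpa using hc)] at key
        have h3 := card_quadratic_roots hchar ha 0 c
        rw [zero_pow two_ne_zero] at h3
        simp only [ha, hc, if_true, if_false]
        have h0 : (0 : F) - a * c ≠ 0 := by simpa using hac
        rcases quadraticChar_dichotomy h0 with h | h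
        · rw [h] at h3
          rw [if_neg (by rw [h]; norm_num), b2]
          omega
        · rw [h] at h3
          rw [if_pos h, b1]
          omega
    · by_cases hc : c = 0
      · subst hc
        replace key := key (by simpa using hb)
        have : ({s : F | s = 0 ∨ a * s = b ∨ b * s = 0 ∨ a * s ^ 2 - 2 * b * s + 0 = 0} :
            Finset F) = {0, b / a, 2 * b / a} := by
          ext s
          have h3 : a * s = b ↔ s = b / a := by rw [eq_div_iff ha, mul_comm]
          have h4 : a * s ^ 2 - 2 * b * s + 0 = 0 ↔ s = 0 ∨ s = 2 * b / a := by
            rw [eq_div_iff ha, ← sub_eq_zero (a := s * a), ← mul_eq_zero]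
            constructor <;> intro h <;> linear_combination h
          simp only [mem_filter, mem_univ, true_and, h3, h4, mem_insert, mem_singleton,
            mul_eq_zero, hb, false_or]
          tauto
        rw [this, card_eq_three.2 ⟨0, b / a, 2 * b / a, (div_ne_zero hb ha).symm,
          (div_ne_zero (mul_ne_zero h2 hb) ha).symm, ?_, rfl⟩] at key
        · simp only [ha, hb, if_true, if_false, b2]
          omega
        · intro h
          field_simp at h
          have : (1 : F) = 0 := by linear_combination -h
          exact one_ne_zero this
      · by_cases hbac : b ^ 2 = a * c
        · simp [hbac, ha, hb, hc] at hz
        replace key := key hbac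
        have hd : b ^ 2 - a * c ≠ 0 := sub_ne_zero.2 hbac
        rw [card_exceptional ha hb hc hbac] at key
        have h3 := card_quadratic_roots hchar ha b c
        simp only [ha, hb, hc, hbac, if_false]
        rcases quadraticChar_dichotomy hd with h | h
        · rw [h] at h3
          rw [if_pos h, b3]
          omega
        · rw [h] at h3
          rw [if_neg (by rw [h]; norm_num), b2]
          omega

/-- For a ≠ 0 the map c ↦ b² − ac is a bijection, so each of the values ±1 of the character is taken
by m = (q−1)/2 choices of c; only c = 0 needs separate care. -/
theorem card_oddClass (hF : Odd (Fintype.card F)) (hq : 7 ≤ Fintype.card F)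
    {j : ℕ} (hj : j ∈ Set.Icc 1 4) :
    #{z : Fin 3 → F | oddClass (z 0) (z 1) (z 2) = j} =
      (Fintype.card F - 1) * classSize (Fintype.card F) j := by
  have hchar : ringChar F ≠ 2 := fun h => by
    have := FiniteField.even_card_iff_char_two.1 h
    rw [Nat.odd_iff] at hF; omega
  obtain ⟨m, hm⟩ := id hF
  obtain ⟨s1, s2, s3, s4⟩ := classSize_odd hF
  obtain ⟨c1, c2⟩ := card_quadraticChar_eq hchar
  have e1 : #{u : F | quadraticChar F u = 1} = m := by omega
  have e2 : #{u : F | quadraticChar F u = -1} = m := by omega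
  have hne : #{c : F | c ≠ 0} = 2 * m := by
    rw [filter_ne', card_erase_of_mem (mem_univ _), card_univ, hm]; omega
  have heq : #{c : F | c = 0} = 1 := by simp [filter_eq']
  have f1 : ∀ a : F, a ≠ 0 → ∀ d : F, #{c : F | quadraticChar F (d - a * c) = 1} = m :=
    fun a ha d => by rw [card_filter_sub_mul ha d (fun u => quadraticChar F u = 1), e1]
  have f2 : ∀ a : F, a ≠ 0 → ∀ d : F, #{c : F | quadraticChar F (d - a * c) = -1} = m :=
    fun a ha d => by rw [card_filter_sub_mul ha d (fun u => quadraticChar F u = -1), e2]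
  have hdich : ∀ a : F, a ≠ 0 → ∀ c : F, c ≠ 0 →
      (quadraticChar F (0 - a * c) = 1 ↔ quadraticChar F (0 - a * c) ≠ -1) := by
    intro a ha c hc
    rcases quadraticChar_dichotomy (a := 0 - a * c) (by simp [ha, hc]) with h | h <;> simp [h, -quadraticChar_apply, -zero_sub]
  have hsq : ∀ b : F, b ≠ 0 → quadraticChar F (b ^ 2) = 1 := fun b hb => quadraticChar_sq_one' hb
  obtain ⟨hj1, hj4⟩ := hj
  have hm1 : Fintype.card F - 1 = 2 * m := by omega
  interval_cases j
  · rw [card_filter_of_zero_pattern (fun a b c => oddClass a b c = 1) (n₀₀ := 0) (n₀₁ := 1)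
      (n₁₀ := m) (n₁₁ := 0), hm1]
    · rw [s1]
      rw [hm, show (2 * m + 1 + 1) / 2 = m + 1 by omega]
      ring
    · rw [card_eq_zero, filter_eq_empty_iff]
      intro c _; simp [oddClass]; split_ifs <;> simp
    · intro b hb
      refine Eq.trans ?_ heq
      congr 1; ext c; simp [oddClass, hb]
    · intro a ha
      rw [← f2 a ha 0]
      congr 1; ext c
      by_cases hc : c = 0
      · simp [oddClass, ha, hc]
      · simp [oddClass, ha, hc]
    · intro a ha b hb
      rw [card_eq_zero, filter_eq_empty_iff]
      intro c _; simp [oddClass, ha, hb]; split_ifs <;> simp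
  · rw [card_filter_of_zero_pattern (fun a b c => oddClass a b c = 2) (n₀₀ := 0) (n₀₁ := 2 * m)
      (n₁₀ := m) (n₁₁ := m + 1), hm1]
    · rw [s2]
      rw [hm, show (2 * m + 1 - 1) * (2 * m + 1 + 4) / 2 = m * (2 * m + 5) by
        rw [show 2 * m + 1 - 1 = 2 * m by omega, mul_assoc, Nat.mul_div_cancel_left _ two_pos]]
      ring
    · rw [card_eq_zero, filter_eq_empty_iff]
      intro c _; simp [oddClass]; split_ifs <;> simp
    · intro b hb
      refine Eq.trans ?_ hne
      congr 1; ext c; simp [oddClass, hb]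
    · intro a ha
      rw [← f1 a ha 0]
      congr 1; ext c
      by_cases hc : c = 0
      · simp [oddClass, ha, hc]
      · simp only [oddClass, ha, hc, if_false, if_true, mem_filter, mem_univ, true_and,
          hdich a ha c hc]
        split_ifs with h <;> simp [h, -quadraticChar_apply, -zero_sub]
    · intro a ha b hb
      -- At c = 0 the point lies on the tangent at (1,0,0), hence in class 2, although b² is a
      -- square; this accounts for m + 1 here and m − 1 for class 3.
      have : ({c | oddClass a b c = 2} : Finset F) =
          insert 0 ({c | quadraticChar F (b ^ 2 - a * c) = -1} : Finset F) := by
        ext c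
        by_cases hc : c = 0
        · simp [oddClass, ha, hb, hc]
        · by_cases hd : b ^ 2 = a * c
          · simp [oddClass, ha, hb, hc, hd]
          · rcases quadraticChar_dichotomy (sub_ne_zero.2 hd) with h | h <;>
              simp [oddClass, ha, hb, hc, hd, h, -quadraticChar_apply]
      rw [this, card_insert_of_notMem, f2 a ha]
      simp [hsq, hb, -quadraticChar_apply]
  · rw [card_filter_of_zero_pattern (fun a b c => oddClass a b c = 3) (n₀₀ := 0) (n₀₁ := 0)
      (n₁₀ := 0) (n₁₁ := m - 1), hm1]
    · rw [s3]
      rw [hm, show (2 * m + 1 - 1) * (2 * m + 1 - 3) / 2 = m * (2 * (m - 1)) by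
        rw [show 2 * m + 1 - 1 = 2 * m by omega, mul_assoc, Nat.mul_div_cancel_left _ two_pos,
          show 2 * m + 1 - 3 = 2 * (m - 1) by omega]]
      ring
    · rw [card_eq_zero, filter_eq_empty_iff]
      intro c _; simp [oddClass]; split_ifs <;> simp
    · intro b hb
      rw [card_eq_zero, filter_eq_empty_iff]
      intro c _; simp [oddClass, hb]; split_ifs <;> simp
    · intro a ha
      rw [card_eq_zero, filter_eq_empty_iff]
      intro c _; simp [oddClass, ha]; split_ifs <;> simp
    · intro a ha b hb
      have : ({c | oddClass a b c = 3} : Finset F) =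
          ({c | quadraticChar F (b ^ 2 - a * c) = 1} : Finset F).erase 0 := by
        ext c
        by_cases hc : c = 0
        · simp [oddClass, ha, hb, hc]
        · by_cases hd : b ^ 2 = a * c
          · simp [oddClass, ha, hb, hc, hd]
          · simp [oddClass, ha, hb, hc, hd]
      rw [this, card_erase_of_mem, f1 a ha]
      simp [hsq, hb, -quadraticChar_apply]
  · rw [card_filter_of_zero_pattern (fun a b c => oddClass a b c = 4) (n₀₀ := 2 * m) (n₀₁ := 0)
      (n₁₀ := 1) (n₁₁ := 0), hm1]
    · rw [s4]
      ring
    · rw [← hne]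
      congr 1; ext c; simp [oddClass]
    · intro b hb
      rw [card_eq_zero, filter_eq_empty_iff]
      intro c _; simp [oddClass, hb]; split_ifs <;> simp
    · intro a ha
      refine Eq.trans ?_ heq
      congr 1; ext c
      simp [oddClass, ha]
      split_ifs <;> simp_all
    · intro a ha b hb
      rw [card_eq_zero, filter_eq_empty_iff]
      intro c _; simp [oddClass, ha, hb]; split_ifs <;> simp

end OddOrder

/-! ### Classes for even q. -/

section EvenOrder

open Finset

variable {F : Type*} [Field F] [Fintype F] [DecidableEq F]

/-- The class of a vector for even `q`; class `0` consists of the zero vector and of the vectors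
on the conic with non-zero coordinates. -/
def evenClass (a b c : F) : ℕ :=
  if a = 0 then
    if b = 0 then (if c = 0 then 0 else 3) else (if c = 0 then 3 else 1)
  else if b = 0 then (if c = 0 then 3 else 1)
  else if c = 0 then 1
  else if b ^ 2 = a * c then 0 else 2

omit [Fintype F] in
theorem evenClass_le (a b c : F) : evenClass a b c ≤ 3 := by
  unfold evenClass; split_ifs <;> omega

omit [Fintype F] in
theorem evenClass_eq_zero_iff (z : Fin 3 → F) :
    evenClass (z 0) (z 1) (z 2) = 0 ↔ ∃ t, z ∈ spanOn unitConicVec {t} := by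
  rw [mem_spanOn_unitConicVec_singleton]
  have h0 : z = 0 ↔ z 0 = 0 ∧ z 1 = 0 ∧ z 2 = 0 := by
    simp [funext_iff, Fin.forall_fin_succ]
  rw [h0]
  generalize z 0 = a, z 1 = b, z 2 = c
  unfold evenClass
  split_ifs <;> simp_all

/-- Without the middle term the fixed-point equation is as² + c = 0. Class 1, the points on the
removed chord or on the tangents at its ends, has 2 exceptional parameters; class 2 has 4. The
removed points and the nucleus (0,1,0) lie on no bisecant. -/
theorem pairCount_of_evenClass (hF : ¬ Odd (Fintype.card F)) (z : Fin 3 → F)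
    (hz : evenClass (z 0) (z 1) (z 2) ≠ 0) :
    pairCount unitConicVec z =
      classBisecants (Fintype.card F) (evenClass (z 0) (z 1) (z 2)) := by
  have hchar : ringChar F = 2 := by
    rw [FiniteField.even_card_iff_char_two]
    rw [Nat.odd_iff] at hF; omega
  obtain ⟨b1, b2, b3⟩ := classBisecants_even hF
  have h2 : (2 : F) = 0 := by
    have := ringChar.Nat.cast_ringChar (R := F)
    rw [hchar] at this
    exact_mod_cast this
  have key := two_mul_pairCount_unitConicVec (z := z)
  have key0 := pairCount_unitConicVec_eq_zero (z := z)
  generalize pairCount unitConicVec z = n at *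
  generalize z 0 = a, z 1 = b, z 2 = c at *
  simp only [h2, zero_mul, sub_zero] at key
  unfold evenClass at hz ⊢
  -- Squaring is bijective in characteristic 2, so exactly one fixed point exists when a ≠ 0.
  have hroot : a ≠ 0 → ∃ r, a * r ^ 2 = c ∧ ∀ s, a * s ^ 2 + c = 0 ↔ s = r := by
    intro ha
    obtain ⟨r, hr⟩ := FiniteField.isSquare_of_char_two hchar (c / a)
    have hr' : a * r ^ 2 = c := by
      rw [pow_two, ← hr]; field_simp
    refine ⟨r, hr', fun s => ⟨fun h => ?_, fun h => ?_⟩⟩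
    · have : a * (s - r) ^ 2 = 0 := by
        linear_combination h + hr' - a * s * r * h2
      exact sub_eq_zero.1 (pow_eq_zero_iff two_ne_zero |>.1 ((mul_eq_zero.1 this).resolve_left ha))
    · rw [h]; linear_combination hr' + c * h2
  by_cases ha : a = 0
  · subst ha
    by_cases hb : b = 0
    · subst hb
      by_cases hc : c = 0
      · simp [hc] at hz
      · simp only [hc, if_true, if_false]
        rw [key0 fun s t _ => by simpa using hc, b3]
    · by_cases hc : c = 0
      · subst hc
        simp only [hb, if_true, if_false]
        rw [key0 ?_, b3]
        -- At the nucleus the chord equation is b(s + t) = 0, which in characteristic 2 means s = t.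
        intro s t hst h
        have h3 : b * ((s : F) - t) = 0 := by linear_combination -h - b * t * h2
        exact hst (Units.ext (sub_eq_zero.1 ((mul_eq_zero.1 h3).resolve_left hb)))
      · replace key := key (by simpa using hb)
        have : ({s : F | s = 0 ∨ 0 = b ∨ b * s = c ∨ 0 + c = 0} : Finset F) = {0, c / b} := by
          ext s
          have h3 : b * s = c ↔ s = c / b := by rw [eq_div_iff hb, mul_comm]
          simp [h3, hc, Ne.symm hb]
        simp only [zero_mul] at key
        rw [this, card_pair (div_ne_zero hc hb).symm] at key
        simp only [hb, hc, if_true, if_false, b1]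
        omega
  · obtain ⟨r, hr, hroot⟩ := hroot ha
    by_cases hb : b = 0
    · subst hb
      by_cases hc : c = 0
      · simp only [hc, if_true]
        rw [key0 (by intro s t _; simp [ha, hc]), if_neg ha, b3]
      · replace key := key (by simpa using ⟨ha, hc⟩)
        have : ({s : F | s = 0 ∨ a * s = 0 ∨ 0 = c ∨ a * s ^ 2 + c = 0} : Finset F) = {0, r} := by
          ext s; simp [ha, Ne.symm hc, hroot]
        have hr0 : 0 ≠ r := by
          rintro rfl
          exact hc (by rw [← hr]; simp)
        simp only [zero_mul] at key
        rw [this, card_pair hr0] at key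
        simp only [ha, hc, if_true, if_false, b1]
        omega
    · by_cases hc : c = 0
      · subst hc
        replace key := key (by simpa using hb)
        have : ({s : F | s = 0 ∨ a * s = b ∨ b * s = 0 ∨ a * s ^ 2 + 0 = 0} : Finset F) =
            {0, b / a} := by
          ext s
          have h3 : a * s = b ↔ s = b / a := by rw [eq_div_iff ha, mul_comm]
          simp [h3, ha, hb]
          tauto
        rw [this, card_pair (div_ne_zero hb ha).symm] at key
        simp only [ha, hb, if_true, if_false, b1]
        omega
      · by_cases hbac : b ^ 2 = a * c
        · simp [hbac, ha, hb, hc] at hz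
        replace key := key hbac
        have : ({s : F | s = 0 ∨ a * s = b ∨ b * s = c ∨ a * s ^ 2 + c = 0} : Finset F) =
            {0, b / a, c / b, r} := by
          ext s
          have h3 : a * s = b ↔ s = b / a := by rw [eq_div_iff ha, mul_comm]
          have h4 : b * s = c ↔ s = c / b := by rw [eq_div_iff hb, mul_comm]
          simp [h3, h4, hroot]
        have n1 : c / b ∉ ({r} : Finset F) := by
          rw [mem_singleton]
          rintro rfl
          field_simp at hr
          exact hbac hr.symm
        have n2 : b / a ∉ ({c / b, r} : Finset F) := by
          simp only [mem_insert, mem_singleton, not_or]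
          constructor
          · rw [div_eq_div_iff ha hb]
            intro h
            exact hbac (by linear_combination h)
          · rintro rfl
            field_simp at hr
            exact hbac hr
        have n3 : (0 : F) ∉ ({b / a, c / b, r} : Finset F) := by
          simp only [mem_insert, mem_singleton, not_or]
          refine ⟨(div_ne_zero hb ha).symm, (div_ne_zero hc hb).symm, ?_⟩
          rintro rfl
          exact hc (by rw [← hr]; simp)
        rw [this, card_insert_of_notMem n3, card_insert_of_notMem n2,
          card_insert_of_notMem n1, card_singleton] at key
        simp only [ha, hb, hc, hbac, if_false, b2]
        omega

theorem card_evenClass (hF : ¬ Odd (Fintype.card F)) {j : ℕ} (hj : j ∈ Set.Icc 1 3) :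
    #{z : Fin 3 → F | evenClass (z 0) (z 1) (z 2) = j} =
      (Fintype.card F - 1) * classSize (Fintype.card F) j := by
  obtain ⟨s1, s2, s3⟩ := classSize_even hF
  have hne : #{c : F | c ≠ 0} = Fintype.card F - 1 := by
    rw [filter_ne', card_erase_of_mem (mem_univ _), card_univ]
  have heq : #{c : F | c = 0} = 1 := by simp [filter_eq']
  obtain ⟨hj1, hj3⟩ := hj
  interval_cases j
  · rw [card_filter_of_zero_pattern (fun a b c => evenClass a b c = 1) (n₀₀ := 0)
      (n₀₁ := Fintype.card F - 1) (n₁₀ := Fintype.card F - 1) (n₁₁ := 1), s1]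
    · ring
    · rw [card_eq_zero, filter_eq_empty_iff]
      intro c _; simp [evenClass]; split_ifs <;> simp
    · intro b hb
      refine Eq.trans ?_ hne
      congr 1; ext c; simp [evenClass, hb]
    · intro a ha
      refine Eq.trans ?_ hne
      congr 1; ext c; simp [evenClass, ha]
    · intro a ha b hb
      refine Eq.trans ?_ heq
      congr 1; ext c
      simp only [evenClass, ha, hb, if_false, mem_filter, mem_univ, true_and]
      split_ifs <;> simp_all
  · rw [card_filter_of_zero_pattern (fun a b c => evenClass a b c = 2) (n₀₀ := 0) (n₀₁ := 0)
      (n₁₀ := 0) (n₁₁ := Fintype.card F - 2), s2]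
    · ring
    · rw [card_eq_zero, filter_eq_empty_iff]
      intro c _; simp [evenClass]; split_ifs <;> simp
    · intro b hb
      rw [card_eq_zero, filter_eq_empty_iff]
      intro c _; simp [evenClass, hb]; split_ifs <;> simp
    · intro a ha
      rw [card_eq_zero, filter_eq_empty_iff]
      intro c _; simp [evenClass, ha]; split_ifs <;> simp
    · intro a ha b hb
      have : ({c | evenClass a b c = 2} : Finset F) = {0, b ^ 2 / a}ᶜ := by
        ext c
        have h3 : b ^ 2 = a * c ↔ c = b ^ 2 / a := by rw [eq_div_iff ha, mul_comm, eq_comm]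
        by_cases hc : c = 0
        · simp [evenClass, ha, hb, hc]
        · by_cases hd : b ^ 2 = a * c
          · simp [evenClass, ha, hb, hc, hd]
          · have := mt h3.2 hd
            simp [evenClass, ha, hb, hc, hd, this]
      rw [this, card_compl, card_pair (div_ne_zero (pow_ne_zero 2 hb) ha).symm]
  · rw [card_filter_of_zero_pattern (fun a b c => evenClass a b c = 3)
      (n₀₀ := Fintype.card F - 1) (n₀₁ := 1) (n₁₀ := 1) (n₁₁ := 0), s3]
    · ring
    · refine Eq.trans ?_ hne
      congr 1; ext c; simp [evenClass]
    · intro b hb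
      refine Eq.trans ?_ heq
      congr 1; ext c; simp [evenClass, hb]
    · intro a ha
      refine Eq.trans ?_ heq
      congr 1; ext c; simp [evenClass, ha]
    · intro a ha b hb
      rw [card_eq_zero, filter_eq_empty_iff]
      intro c _; simp [evenClass, ha, hb]; split_ifs <;> simp

end EvenOrder

/-! ### The classification for both parities. -/

section Classification

open Finset

variable {F : Type*} [Field F] [Fintype F] [DecidableEq F]

/-- The number of bisecants determines the class. For q = 5 or q = 4 the last two values would both
be 0; the bound on q excludes this. -/
theorem classBisecants_injOn {q : ℕ} (hq : 7 ≤ q) :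
    Set.InjOn (classBisecants q) (Set.Icc 1 (numClasses q)) := by
  rintro i ⟨hi1, hi⟩ j ⟨hj1, hj⟩ hij
  by_cases hF : Odd q
  · obtain ⟨b1, b2, b3, b4⟩ := classBisecants_odd hF
    obtain ⟨m, hm⟩ := id hF
    rw [numClasses, if_pos hF] at hi hj
    interval_cases i <;> interval_cases j <;> omega
  · obtain ⟨b1, b2, b3⟩ := classBisecants_even hF
    obtain ⟨m, hm⟩ := Nat.not_odd_iff_even.1 hF
    rw [numClasses, if_neg hF] at hi hj
    interval_cases i <;> interval_cases j <;> omega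

theorem classBisecants_eq_zero_iff {q : ℕ} (hq : 7 ≤ q) {j : ℕ}
    (hj : j ∈ Set.Icc 1 (numClasses q)) : classBisecants q j = 0 ↔ j = numClasses q := by
  have h0 : classBisecants q (numClasses q) = 0 := by
    unfold numClasses
    split_ifs with hF
    · exact (classBisecants_odd hF).2.2.2
    · exact (classBisecants_even hF).2.2
  refine ⟨fun h => classBisecants_injOn hq hj ⟨hj.1.trans hj.2, le_rfl⟩ (h.trans h0.symm), ?_⟩
  rintro rfl
  exact h0

/-- The classes of the vectors off the conic without two points. -/
theorem exists_classification_unitConicVec (hq : 7 ≤ Fintype.card F) :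
    ∃ cls : (Fin 3 → F) → ℕ, (∀ z, cls z ≤ numClasses (Fintype.card F)) ∧
      (∀ z, cls z = 0 ↔ ∃ t, z ∈ spanOn unitConicVec {t}) ∧
      (∀ z, cls z ≠ 0 →
        pairCount unitConicVec z = classBisecants (Fintype.card F) (cls z)) ∧
      ∀ j ∈ Set.Icc 1 (numClasses (Fintype.card F)),
        #{z | cls z = j} = (Fintype.card F - 1) * classSize (Fintype.card F) j := by
  unfold numClasses
  split_ifs with hF
  · exact ⟨fun z => oddClass (z 0) (z 1) (z 2), fun z => oddClass_le _ _ _,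
      oddClass_eq_zero_iff, pairCount_of_oddClass hF hq, fun j hj => card_oddClass hF hq hj⟩
  · exact ⟨fun z => evenClass (z 0) (z 1) (z 2), fun z => evenClass_le _ _ _,
      evenClass_eq_zero_iff, pairCount_of_evenClass hF, fun j hj => card_evenClass hF hj⟩

end Classification

/-! ### Invariance under linear maps, relabelling and rescaling. -/

section Transfer

open Finset

variable {F ι κ : Type*} [Field F] {h : ι → Fin 3 → F} {k : κ → Fin 3 → F}

/-- Rescaling generators by units does not change a span, so g carries the spans of the first family
to those of the second. -/
theorem mem_spanOn_map_iff (g : (Fin 3 → F) ≃ₗ[F] (Fin 3 → F)) (ε : ι ≃ κ) (u : ι → Fˣ)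
    (hg : ∀ i, g (h i) = u i • k (ε i)) (z : Fin 3 → F) (T : Finset ι) :
    g z ∈ spanOn k (T.map ε.toEmbedding) ↔ z ∈ spanOn h T := by
  have : spanOn k (T.map ε.toEmbedding) = (spanOn h T).map (g : (Fin 3 → F) →ₗ[F] _) := by
    rw [spanOn, spanOn, Submodule.map_span]
    apply le_antisymm
    · rw [Submodule.span_le]
      rintro _ ⟨_, ht, rfl⟩
      simp only [coe_map, Set.mem_image, mem_coe, Equiv.coe_toEmbedding] at ht
      obtain ⟨i, hi, rfl⟩ := ht
      have h1 : k (ε i) = ((u i)⁻¹ : Fˣ) • g (h i) := by rw [hg, inv_smul_smul]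
      rw [h1, Units.smul_def]
      exact Submodule.smul_mem _ _ (Submodule.subset_span ⟨h i, ⟨i, hi, rfl⟩, rfl⟩)
    · rw [Submodule.span_le]
      rintro _ ⟨_, ⟨i, hi, rfl⟩, rfl⟩
      change g (h i) ∈ _
      rw [hg, Units.smul_def]
      exact Submodule.smul_mem _ _ (Submodule.subset_span ⟨ε i, by simpa using hi, rfl⟩)
  rw [this]
  exact ⟨fun ⟨y, hy, hyz⟩ => g.injective hyz ▸ hy, fun hz => ⟨z, hz, rfl⟩⟩

theorem exists_mem_spanOn_singleton_iff (g : (Fin 3 → F) ≃ₗ[F] (Fin 3 → F)) (ε : ι ≃ κ)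
    (u : ι → Fˣ) (hg : ∀ i, g (h i) = u i • k (ε i)) (z : Fin 3 → F) :
    (∃ t, g z ∈ spanOn k {t}) ↔ ∃ i, z ∈ spanOn h {i} := by
  rw [← ε.exists_congr_right]
  refine exists_congr fun i => ?_
  rw [← mem_spanOn_map_iff g ε u hg z {i}, map_singleton]
  rfl

theorem pairCount_map [Fintype ι] [Fintype κ] [DecidableEq ι] [DecidableEq κ]
    (g : (Fin 3 → F) ≃ₗ[F] (Fin 3 → F)) (ε : ι ≃ κ) (u : ι → Fˣ)
    (hg : ∀ i, g (h i) = u i • k (ε i)) (z : Fin 3 → F) :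
    pairCount k (g z) = pairCount h z := by
  symm
  refine card_bij (fun T _ => T.map ε.toEmbedding) ?_ ?_ ?_
  · intro T hT
    simp only [mem_filter, mem_powersetCard, subset_univ, true_and, card_map] at hT ⊢
    exact ⟨hT.1, (mem_spanOn_map_iff g ε u hg z T).2 hT.2⟩
  · intro T _ T' _ h
    exact map_injective _ h
  · intro T hT
    simp only [mem_filter, mem_powersetCard, subset_univ, true_and] at hT
    have h1 : (T.map ε.symm.toEmbedding).map ε.toEmbedding = T := by
      ext; simp
    refine ⟨T.map ε.symm.toEmbedding, ?_, h1⟩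
    simp only [mem_filter, mem_powersetCard, subset_univ, true_and, card_map]
    exact ⟨hT.1, by rw [← mem_spanOn_map_iff g ε u hg, h1]; exact hT.2⟩

theorem IsArc.comp_smul (hk : IsArc k) {f : ι → κ} (hf : Function.Injective f) (u : ι → Fˣ) :
    IsArc fun i => u i • k (f i) := by
  classical
  intro S hS
  have h1 := hk (S.map ⟨f, hf⟩) (by rw [card_map, hS])
  have h2 : LinearIndependent F fun i : (S : Set ι) => k (f i) :=
    h1.comp (fun i : (S : Set ι) => ⟨f i, by simpa using ⟨_, i.2, rfl⟩⟩) fun i j hij =>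
      Subtype.ext (hf (congrArg Subtype.val hij))
  exact h2.units_smul fun i => u i

end Transfer

/-! ### The conic is an arc; normalizing the two removed points. -/

section Conic

open Finset

variable {F : Type*} [Field F]

theorem conicVec_coeff_eq_zero {i j k : Option F} (hij : i ≠ j) (hik : i ≠ k) (hjk : j ≠ k)
    {x y z : F} (h : x • conicVec i + (y • conicVec j + z • conicVec k) = 0) : x = 0 := by
  have e0 := congrFun h 0
  have e1 := congrFun h 1
  have e2 := congrFun h 2
  rcases i with _ | r <;> rcases j with _ | s <;> rcases k with _ | t <;>
    simp [conicVec] at e0 e1 e2 hij hik hjk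
  · have h1 : z * (s - t) = 0 := by linear_combination s * e0 - e1
    have hz : z = 0 := (mul_eq_zero.1 h1).resolve_right (sub_ne_zero.2 hjk)
    have hy : y = 0 := by simpa [hz] using e0
    simpa [hy, hz] using e2
  · have h1 : x * (r - t) = 0 := by linear_combination e1 - t * e0
    exact (mul_eq_zero.1 h1).resolve_right (sub_ne_zero.2 hik)
  · have h1 : x * (r - s) = 0 := by linear_combination e1 - s * e0
    exact (mul_eq_zero.1 h1).resolve_right (sub_ne_zero.2 hij)
  -- The combination applies the polynomial (X − s)(X − t), which annihilates the vectors of s and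
  -- t.
  · have h1 : x * (r - s) * (r - t) = 0 := by
      linear_combination e2 - (s + t) * e1 + s * t * e0
    exact (mul_eq_zero.1 ((mul_eq_zero.1 h1).resolve_right
      (sub_ne_zero.2 hik))).resolve_right (sub_ne_zero.2 hij)

theorem isArc_conicVec : IsArc (conicVec : Option F → Fin 3 → F) := by
  classical
  intro S hS
  obtain ⟨i, j, k, hij, hik, hjk, rfl⟩ := card_eq_three.1 hS
  rw [linearIndepOn_finset_iff]
  intro c hc
  rw [sum_insert (by simp [hij, hik]), sum_insert (by simp [hjk]), sum_singleton] at hc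
  intro l hl
  simp only [mem_insert, mem_singleton] at hl
  rcases hl with rfl | rfl | rfl
  · exact conicVec_coeff_eq_zero hij hik hjk hc
  · exact conicVec_coeff_eq_zero hij.symm hjk hik (by rw [← hc]; abel)
  · exact conicVec_coeff_eq_zero hik.symm hjk.symm hij (by rw [← hc]; abel)

/-- Any two points of the conic can be moved to `(1, 0, 0)` and `(0, 0, 1)`. -/
theorem exists_linearEquiv_unitConicVec {s₁ s₂ : Option F} (hs : s₁ ≠ s₂) :
    ∃ g : (Fin 3 → F) ≃ₗ[F] (Fin 3 → F), ∀ s, s ≠ s₁ → s ≠ s₂ →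
      ∃ (w : Fˣ) (t : Fˣ), g (conicVec s) = w • unitConicVec t := by
  have hM : ∀ M : Matrix (Fin 3) (Fin 3) F, M.det ≠ 0 →
      ∃ g : (Fin 3 → F) ≃ₗ[F] (Fin 3 → F), ∀ x, g x = M.mulVec x := by
    intro M hM
    have hinj : Function.Injective M.mulVecLin := by
      change Function.Injective M.mulVec
      rw [Matrix.mulVec_injective_iff_isUnit, Matrix.isUnit_iff_isUnit_det]
      exact hM.isUnit
    exact ⟨LinearEquiv.ofInjectiveEndo _ hinj, fun x => rfl⟩
  have hinf : ∀ d : F, ∃ g : (Fin 3 → F) ≃ₗ[F] (Fin 3 → F), ∀ s : Option F, s ≠ none →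
      s ≠ some d → ∃ (w : Fˣ) (t : Fˣ), g (conicVec s) = w • unitConicVec t := by
    intro d
    -- The translation s ↦ s − d acting on (1, s, s²).
    obtain ⟨g, hg⟩ := hM !![1, 0, 0; -d, 1, 0; d ^ 2, -2 * d, 1] (by
      simp [Matrix.det_fin_three])
    refine ⟨g, fun s h1 h2 => ?_⟩
    rcases s with _ | s
    · exact absurd rfl h1
    · refine ⟨1, Units.mk0 (s - d) (sub_ne_zero.2 fun h => h2 (by rw [h])), ?_⟩
      rw [hg, one_smul]
      ext i
      fin_cases i <;> simp [conicVec, unitConicVec, Matrix.mulVec, dotProduct, Fin.sum_univ_three]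
      all_goals ring
  rcases s₁ with _ | d <;> rcases s₂ with _ | e
  · exact absurd rfl hs
  · exact hinf e
  · obtain ⟨g, hg⟩ := hinf d
    exact ⟨g, fun s h1 h2 => hg s h2 h1⟩
  · have hde : d - e ≠ 0 := sub_ne_zero.2 fun h => hs (by rw [h])
    -- This matrix sends (1, s, s²) to ((s−e)², (s−d)(s−e), (s−d)²), that is, it induces s ↦
    -- (s−d)/(s−e) with d ↦ 0, e ↦ ∞ and ∞ ↦ 1. Its determinant is (d−e)³ up to sign.
    obtain ⟨g, hg⟩ := hM !![e ^ 2, -2 * e, 1; d * e, -(d + e), 1; d ^ 2, -2 * d, 1] (by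
      rw [Matrix.det_fin_three]
      simp
      intro h
      refine pow_ne_zero 3 hde ?_
      linear_combination h)
    refine ⟨g, fun s h1 h2 => ?_⟩
    rcases s with _ | s
    · refine ⟨1, 1, ?_⟩
      rw [hg, one_smul]
      ext i
      fin_cases i <;> simp [conicVec, unitConicVec, Matrix.mulVec, dotProduct, Fin.sum_univ_three]
    · have hd : s - d ≠ 0 := sub_ne_zero.2 fun h => h1 (by rw [h])
      have he : s - e ≠ 0 := sub_ne_zero.2 fun h => h2 (by rw [h])
      refine ⟨Units.mk0 ((s - e) ^ 2) (pow_ne_zero 2 he),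
        Units.mk0 ((s - d) / (s - e)) (div_ne_zero hd he), ?_⟩
      rw [hg]
      ext i
      fin_cases i <;>
        simp [conicVec, unitConicVec, Matrix.mulVec, dotProduct, Fin.sum_univ_three,
          Units.smul_def] <;> field_simp <;> ring

variable [Fintype F] [DecidableEq F]

omit [Field F] in
theorem card_option_ne_ne {s₁ s₂ : Option F} (hs : s₁ ≠ s₂) :
    Fintype.card {s : Option F // s ≠ s₁ ∧ s ≠ s₂} = Fintype.card F - 1 := by
  rw [Fintype.card_subtype]
  have : ({s | s ≠ s₁ ∧ s ≠ s₂} : Finset (Option F)) = {s₁, s₂}ᶜ := by ext; simp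
  rw [this, card_compl, card_pair hs, Fintype.card_option]
  omega

/-- The classes of the vectors off the conic without two of its points, with respect to
arbitrary homogeneous coordinates of the remaining points. -/
theorem exists_classification (hq : 7 ≤ Fintype.card F) {s₁ s₂ : Option F} (hs : s₁ ≠ s₂)
    {ι : Type*} [Fintype ι] [DecidableEq ι] (e : ι ≃ {s : Option F // s ≠ s₁ ∧ s ≠ s₂})
    (u : ι → Fˣ) {h : ι → Fin 3 → F} (hh : ∀ i, h i = u i • conicVec (e i : Option F)) :
    ∃ cls : (Fin 3 → F) → ℕ, (∀ z, cls z ≤ numClasses (Fintype.card F)) ∧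
      (∀ z, cls z = 0 ↔ ∃ i, z ∈ spanOn h {i}) ∧
      (∀ z, cls z ≠ 0 → pairCount h z = classBisecants (Fintype.card F) (cls z)) ∧
      ∀ j ∈ Set.Icc 1 (numClasses (Fintype.card F)),
        #{z | cls z = j} = (Fintype.card F - 1) * classSize (Fintype.card F) j := by
  obtain ⟨cls, c1, c2, c3, c4⟩ := exists_classification_unitConicVec hq
  obtain ⟨g, hg⟩ := exists_linearEquiv_unitConicVec hs
  choose w t hwt using fun i : ι => hg (e i) (e i).2.1 (e i).2.2
  have hcard : Fintype.card ι = Fintype.card F - 1 := by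
    rw [Fintype.card_congr e, card_option_ne_ne hs]
  have harc : IsArc h := by
    have := isArc_conicVec.comp_smul (Subtype.val_injective.comp e.injective) u
    exact (funext hh : h = _) ▸ this
  -- Equal parameters would make two arc vectors proportional. As there are q − 1 indices and q − 1
  -- units, injectivity suffices for a bijection.
  have hinj : Function.Injective t := by
    intro i j hij
    have h1 : h i = (u i * w i * (w j)⁻¹ * (u j)⁻¹) • h j := by
      apply g.injective
      rw [hh, hh, Units.smul_def, Units.smul_def, Units.smul_def, map_smul, map_smul, map_smul,
        hwt, hwt, hij]
      simp only [← Units.smul_def, smul_smul]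
      congr 1
      group
    have h2 := (harc.mem_spanOn_iff (by omega) (T := {j}) (by simp) i).1 (by
      rw [h1, Units.smul_def]
      exact Submodule.smul_mem _ _ (Submodule.subset_span ⟨j, by simp, rfl⟩))
    simpa using h2
  have hbij : Function.Bijective t :=
    (Fintype.bijective_iff_injective_and_card t).2 ⟨hinj, by rw [hcard, Fintype.card_units]⟩
  have hgh : ∀ i, g (h i) = (u i * w i) • unitConicVec (Equiv.ofBijective t hbij i) := by
    intro i
    rw [hh, Units.smul_def, map_smul, hwt, mul_smul]
    rfl
  refine ⟨fun z => cls (g z), fun z => c1 _, fun z => ?_, fun z hz => ?_, fun j hj => ?_⟩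
  · rw [c2, exists_mem_spanOn_singleton_iff g _ _ hgh]
  · rw [← c3 _ hz, pairCount_map g _ _ hgh]
  · rw [← c4 j hj]
    refine card_bij' (fun z _ => g z) (fun z _ => g.symm z) ?_ ?_ ?_ ?_ <;> simp

end Conic

/-! ### From counts of vectors to counts of points. -/

section Points

variable {F : Type*} [Field F] [Fintype F]

/-- Every point has exactly q − 1 coordinate vectors, the unit multiples of one representative. -/
theorem ncard_setOf_mk_mem (A : Set (ℙ F (Fin 3 → F))) :
    {z : Fin 3 → F | ∃ hz : z ≠ 0, Projectivization.mk F z hz ∈ A}.ncard =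
      (Fintype.card F - 1) * A.ncard := by
  classical
  have h1 : {z : Fin 3 → F | ∃ hz : z ≠ 0, Projectivization.mk F z hz ∈ A} =
      (fun p : ℙ F (Fin 3 → F) × Fˣ => p.2 • p.1.rep) '' (A ×ˢ Set.univ) := by
    ext z
    simp only [Set.mem_ofPred_eq, Set.mem_image, Set.mem_prod, Set.mem_univ, and_true,
      Prod.exists]
    constructor
    · rintro ⟨hz, hA⟩
      obtain ⟨a, ha⟩ := Projectivization.exists_smul_eq_mk_rep F z hz
      exact ⟨_, a⁻¹, hA, by rw [← ha, inv_smul_smul]⟩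
    · rintro ⟨P, a, hP, rfl⟩
      have h0 : a • P.rep ≠ 0 := (smul_ne_zero_iff_ne a).2 P.rep_nonzero
      refine ⟨h0, ?_⟩
      have : Projectivization.mk F (a • P.rep) h0 = P := by
        conv_rhs => rw [← P.mk_rep]
        rw [Projectivization.mk_eq_mk_iff]
        exact ⟨a, rfl⟩
      rwa [this]
  rw [h1, Set.InjOn.ncard_image, Set.ncard_prod, Set.ncard_univ, Nat.card_eq_fintype_card,
    Fintype.card_units, mul_comm]
  rintro ⟨P, a⟩ - ⟨Q, b⟩ - h
  have hPQ : P = Q := by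
    rw [← P.mk_rep, ← Q.mk_rep, Projectivization.mk_eq_mk_iff]
    refine ⟨a⁻¹ * b, ?_⟩
    change a • P.rep = b • Q.rep at h
    rw [mul_smul, ← h, inv_smul_smul]
  subst hPQ
  rw [Prod.mk.injEq]
  refine ⟨rfl, Units.ext (smul_left_injective F P.rep_nonzero ?_)⟩
  simpa [Units.smul_def] using h

variable {ι : Type*} [Fintype ι] {h : ι → Fin 3 → F}

theorem ncard_compl_range_mk (ha : IsArc h) (hι : 3 ≤ Fintype.card ι)
    (hcard : Fintype.card ι = Fintype.card F - 1) (h0 : ∀ i, h i ≠ 0) :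
    (Set.range fun i => Projectivization.mk F (h i) (h0 i))ᶜ.ncard =
      Fintype.card F ^ 2 + 2 := by
  have h1 : (Set.range fun i => Projectivization.mk F (h i) (h0 i)).ncard =
      Fintype.card F - 1 := by
    rw [← Set.image_univ, Set.ncard_image_of_injective _ (ha.injective_mk hι h0),
      Set.ncard_univ, Nat.card_eq_fintype_card, hcard]
  have h2 := Projectivization.card_of_finrank F (Fin 3 → F) (n := 3) (by simp)
  simp only [Finset.sum_range_succ, Finset.sum_range_zero,
    Nat.card_eq_fintype_card (α := F), pow_zero, pow_one] at h2
  have h3 := Set.ncard_add_ncard_compl (Set.range fun i => Projectivization.mk F (h i) (h0 i))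
  rw [h1, h2] at h3
  omega

/-- The partition of the points off an arc according to the number of bisecants. -/
theorem exists_partition_of_classification (ha : IsArc h) (hι : 3 ≤ Fintype.card ι)
    (hq : 7 ≤ Fintype.card F) (h0 : ∀ i, h i ≠ 0) {S : Set (ℙ F (Fin 3 → F))}
    (hS : S = Set.range fun i => Projectivization.mk F (h i) (h0 i))
    {cls : (Fin 3 → F) → ℕ} (c1 : ∀ z, cls z ≤ numClasses (Fintype.card F))
    (c2 : ∀ z, cls z = 0 ↔ ∃ i, z ∈ spanOn h {i})
    (c3 : ∀ z, cls z ≠ 0 → pairCount h z = classBisecants (Fintype.card F) (cls z))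
    (c4 : ∀ j ∈ Set.Icc 1 (numClasses (Fintype.card F)),
      (Finset.univ.filter fun z => cls z = j).card =
        (Fintype.card F - 1) * classSize (Fintype.card F) j) :
    ∃ A : ℕ → Set (ℙ F (Fin 3 → F)),
      (⋃ j ∈ Set.Icc 1 (numClasses (Fintype.card F)), A j) = Sᶜ ∧
      (Set.Icc 1 (numClasses (Fintype.card F))).PairwiseDisjoint A ∧
      ∀ j ∈ Set.Icc 1 (numClasses (Fintype.card F)),
        (A j).ncard = classSize (Fintype.card F) j ∧
        ∀ P ∈ A j, bisecantCount S P = classBisecants (Fintype.card F) j := by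
  have key : ∀ (z : Fin 3 → F) (hz : z ≠ 0), Projectivization.mk F z hz ∉ S →
      cls z ≠ 0 ∧ bisecantCount S (Projectivization.mk F z hz) =
        classBisecants (Fintype.card F) (cls z) := by
    intro z hz hzS
    subst hS
    rw [mk_mem_range_iff h0 hz, ← c2] at hzS
    exact ⟨hzS, by rw [ha.bisecantCount_eq hι h0 hz, c3 z hzS]⟩
  -- The parts are cut out by the bisecant count, which belongs to the point, so `cls` need not be
  -- known to be invariant under scaling; `classBisecants_injOn` recovers it.
  refine ⟨fun j => {P | P ∉ S ∧ bisecantCount S P = classBisecants (Fintype.card F) j},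
    ?_, ?_, ?_⟩
  · ext P
    simp only [Set.mem_iUnion, Set.mem_ofPred_eq, Set.mem_compl_iff, exists_prop]
    constructor
    · rintro ⟨j, -, hP, -⟩
      exact hP
    · intro hP
      induction P using Projectivization.ind with
      | h z hz =>
        obtain ⟨k1, k2⟩ := key z hz hP
        exact ⟨cls z, ⟨Nat.one_le_iff_ne_zero.2 k1, c1 z⟩, hP, k2⟩
  · intro i hi j hj hij
    rw [Function.onFun, Set.disjoint_left]
    rintro P ⟨-, h1⟩ ⟨-, h2⟩
    exact hij (classBisecants_injOn hq hi hj (h1.symm.trans h2))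
  · intro j hj
    refine ⟨?_, fun P hP => hP.2⟩
    have h1 := ncard_setOf_mk_mem
      {P | P ∉ S ∧ bisecantCount S P = classBisecants (Fintype.card F) j}
    have h2 : {z : Fin 3 → F | ∃ hz : z ≠ 0, Projectivization.mk F z hz ∈
        {P | P ∉ S ∧ bisecantCount S P = classBisecants (Fintype.card F) j}} =
        (Finset.univ.filter fun z => cls z = j : Finset (Fin 3 → F)) := by
      ext z
      simp only [Set.mem_ofPred_eq, Finset.coe_filter, Finset.mem_univ, true_and]
      constructor
      · rintro ⟨hz, hzS, hb⟩
        obtain ⟨k1, k2⟩ := key z hz hzS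
        exact classBisecants_injOn hq ⟨Nat.one_le_iff_ne_zero.2 k1, c1 z⟩ hj
          (k2.symm.trans hb)
      · rintro rfl
        have hcls : cls z ≠ 0 := Nat.one_le_iff_ne_zero.1 hj.1
        have hne : ¬ ∃ i, z ∈ spanOn h {i} := fun h => hcls ((c2 z).2 h)
        have hz : z ≠ 0 := by
          rintro rfl
          obtain ⟨i⟩ : Nonempty ι := Fintype.card_pos_iff.1 (by omega)
          exact hne ⟨i, zero_mem _⟩
        have hzS : Projectivization.mk F z hz ∉ S := by
          rw [hS, mk_mem_range_iff h0 hz]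
          exact hne
        exact ⟨hz, hzS, (key z hz hzS).2⟩
    rw [h2, Set.ncard_coe_finset, c4 j hj] at h1
    exact (Nat.eq_of_mul_eq_mul_left (by omega) h1).symm

end Points

/-! ### The conic without two points as a set of projective points. -/

section ConicPoints

variable {F : Type*} [Field F]

theorem conicPoint_injective : Function.Injective (conicPoint : Option F → ℙ F (Fin 3 → F)) := by
  intro s t hst
  rw [conicPoint, conicPoint, Projectivization.mk_eq_mk_iff'] at hst
  obtain ⟨a, ha⟩ := hst
  have e0 := congrFun ha 0
  have e1 := congrFun ha 1
  rcases s with _ | s <;> rcases t with _ | t <;> simp [conicVec] at e0 e1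
  · rfl
  · simpa [conicVec, e0] using congrFun ha 2
  · rw [← e1, e0, one_mul]

theorem conic_diff_eq_range {s₁ s₂ : Option F} {ι : Type*}
    (e : ι ≃ {s : Option F // s ≠ s₁ ∧ s ≠ s₂}) (u : ι → Fˣ) {h : ι → Fin 3 → F}
    (hh : ∀ i, h i = u i • conicVec (e i : Option F)) (h0 : ∀ i, h i ≠ 0) :
    conic F \ {conicPoint s₁, conicPoint s₂} =
      Set.range fun i => Projectivization.mk F (h i) (h0 i) := by
  have h1 : ∀ i, Projectivization.mk F (h i) (h0 i) = conicPoint (e i : Option F) := by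
    intro i
    rw [conicPoint, Projectivization.mk_eq_mk_iff]
    exact ⟨u i, (hh i).symm⟩
  ext P
  simp only [conic, Set.mem_sdiff, Set.mem_range, Set.mem_insert_iff, Set.mem_singleton_iff, h1]
  constructor
  · rintro ⟨⟨s, rfl⟩, hs⟩
    rw [not_or] at hs
    obtain ⟨i, hi⟩ := e.surjective ⟨s, fun h => hs.1 (by rw [h]), fun h => hs.2 (by rw [h])⟩
    exact ⟨i, by rw [hi]⟩
  · rintro ⟨i, rfl⟩
    refine ⟨⟨_, rfl⟩, ?_⟩
    rw [not_or]
    exact ⟨fun h => (e i).2.1 (conicPoint_injective h),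
      fun h => (e i).2.2 (conicPoint_injective h)⟩

end ConicPoints

/-! ### The code of an arc: parameters, syndromes and coset weights. -/

section ArcCode

open Finset

variable {F : Type*} [Field F] [DecidableEq F] {n : ℕ} {h : Fin n → Fin 3 → F}

omit [DecidableEq F] in
theorem codeOfParityCheck_eq_ker (H : Matrix (Fin 3) (Fin n) F) :
    codeOfParityCheck H = LinearMap.ker (Fintype.linearCombination F H.col) := by
  ext x
  rw [codeOfParityCheck, LinearMap.mem_ker, LinearMap.mem_ker, Matrix.mulVecLin_apply,
    Fintype.linearCombination_apply]
  have : H.mulVec x = ∑ i, x i • H.col i := by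
    ext j
    simp [Matrix.mulVec, dotProduct, Finset.sum_apply, mul_comm]
  rw [this]

/-- The code whose parity check matrix has the vectors `h j` as columns. -/
abbrev columnCode (h : Fin n → Fin 3 → F) : Submodule F (Fin n → F) :=
  LinearMap.ker (Fintype.linearCombination F h)

theorem mem_spanOn_iff_exists_hammingNorm (z : Fin 3 → F) (w : ℕ) :
    (∃ S : Finset (Fin n), #S ≤ w ∧ z ∈ spanOn h S) ↔
      ∃ x, Fintype.linearCombination F h x = z ∧ hammingNorm x ≤ w := by
  simp only [mem_span_image_iff_exists_linearCombination]
  constructor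
  · rintro ⟨S, hS, x, hx, hxS⟩
    refine ⟨x, hx, (card_le_card ?_).trans hS⟩
    intro i hi
    exact hxS i (by simpa using hi)
  · rintro ⟨x, hx, hw⟩
    exact ⟨({i | x i ≠ 0} : Finset _), hw, x, hx, by simp⟩

omit [DecidableEq F] in
theorem IsArc.linearCombination_surjective (ha : IsArc h) (hn : 3 ≤ n) :
    Function.Surjective (Fintype.linearCombination F h) := by
  intro z
  have hz : z ∈ spanOn h (univ : Finset (Fin n)) := by
    rw [ha.span_eq_top (by simpa using hn)]; trivial
  obtain ⟨x, hx, -⟩ := (mem_span_image_iff_exists_linearCombination _ _).1 hz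
  exact ⟨x, hx⟩

omit [DecidableEq F] in
theorem IsArc.exists_small_spanOn (ha : IsArc h) (hn : 3 ≤ n) (z : Fin 3 → F) :
    ∃ S : Finset (Fin n), #S ≤ 3 ∧ z ∈ spanOn h S := by
  obtain ⟨S, -, hS⟩ := Finset.exists_subset_card_eq (s := (univ : Finset (Fin n))) (n := 3)
    (by simpa using hn)
  exact ⟨S, hS.le, by rw [ha.span_eq_top hS.ge]; trivial⟩

omit [DecidableEq F] in
theorem IsArc.finrank_columnCode (ha : IsArc h) (hn : 3 ≤ n) :
    Module.finrank F (columnCode h) = n - 3 := by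
  classical
  have h1 := (Fintype.linearCombination F h).finrank_range_add_finrank_ker
  rw [LinearMap.range_eq_top.2 (ha.linearCombination_surjective hn), finrank_top] at h1
  simp only [Module.finrank_fin_fun] at h1
  change Module.finrank F (LinearMap.ker (Fintype.linearCombination F h)) = n - 3
  omega

/-- A codeword of weight at most 3 is a linear relation among at most three independent columns. -/
theorem IsArc.four_le_hammingNorm (ha : IsArc h) (hn : 3 ≤ n) {x : Fin n → F}
    (hx : x ∈ columnCode h) (h0 : x ≠ 0) : 4 ≤ hammingNorm x := by
  by_contra! hw
  refine h0 (eq_of_linearCombination_eq (h := h) (S := ({i | x i ≠ 0} : Finset (Fin n)))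
    (ha.linearIndepOn (by simpa using hn) ?_) (by simp) (by simp) ?_)
  · exact Nat.lt_succ_iff.1 hw
  · rw [map_zero]; exact hx

theorem IsArc.minDistance_columnCode (ha : IsArc h) (hn : 4 ≤ n) :
    minDistance (columnCode h) = 4 := by
  have hlow : ∀ x ∈ columnCode h, ∀ y ∈ columnCode h, x ≠ y → 4 ≤ hammingDist x y := by
    intro x hx y hy hxy
    rw [hammingDist_eq_hammingNorm]
    exact ha.four_le_hammingNorm (by omega) (neg_add_eq_sub x y ▸ sub_mem hy hx)
      (fun h => hxy (neg_add_eq_zero.1 h))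
  refine IsLeast.csInf_eq ⟨?_, ?_⟩
  -- Four vectors of F³ are dependent: column i is a combination x of the other three, and x − e_i
  -- is a codeword supported in the four positions.
  · obtain ⟨S, -, hS⟩ := Finset.exists_subset_card_eq (s := (univ : Finset (Fin n))) (n := 4)
      (by simpa using hn)
    obtain ⟨i, hi⟩ := card_pos.1 (by omega : 0 < #S)
    have hc : #(S.erase i) = 3 := by rw [card_erase_of_mem hi, hS]
    have hz : h i ∈ spanOn h (S.erase i) := by rw [ha.span_eq_top hc.ge]; trivial
    obtain ⟨x, hx, hxS⟩ := (mem_span_image_iff_exists_linearCombination _ _).1 hz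
    have hsingle : Fintype.linearCombination F h (Pi.single i 1) = h i := by
      rw [Fintype.linearCombination_apply_single, one_smul]
    have hxC : x - Pi.single i 1 ∈ columnCode h := by
      rw [LinearMap.mem_ker, map_sub, hx, hsingle, sub_self]
    have hxi : x i = 0 := by
      by_contra hxi
      simpa using hxS i hxi
    have hne : x - Pi.single i 1 ≠ 0 := by
      intro h0
      have := congrFun h0 i
      simp [hxi] at this
    refine ⟨x - Pi.single i 1, hxC, 0, zero_mem _, hne, ?_⟩
    refine le_antisymm ?_ (hlow _ hxC _ (zero_mem _) hne)
    rw [hammingDist_zero_right, ← hS]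
    refine card_le_card fun j hj => ?_
    simp only [mem_filter, mem_univ, true_and] at hj
    by_contra hjS
    apply hj
    have hji : j ≠ i := fun h => hjS (h ▸ hi)
    have : x j = 0 := by
      by_contra hxj
      exact hjS (mem_of_mem_erase (hxS j hxj))
    simp [this, hji]
  · rintro d ⟨x, hx, y, hy, hxy, rfl⟩
    exact hlow x hx y hy hxy

/-- Three columns span F³, so radius 3 suffices; a syndrome z outside all spans of two columns shows
that 2 does not. -/
theorem IsArc.coveringRadius_columnCode (ha : IsArc h) (hn : 3 ≤ n)
    (hz : ∃ z, ∀ S : Finset (Fin n), #S ≤ 2 → z ∉ spanOn h S) :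
    coveringRadius (columnCode h) = 3 := by
  refine IsLeast.csInf_eq ⟨?_, ?_⟩
  · intro x
    obtain ⟨y, hy, hw⟩ := (mem_spanOn_iff_exists_hammingNorm _ _).1
      (ha.exists_small_spanOn hn (Fintype.linearCombination F h x))
    refine ⟨x - y, by rw [LinearMap.mem_ker, map_sub, hy, sub_self], ?_⟩
    rw [hammingDist_comm, hammingDist_eq_hammingNorm]
    simpa using hw
  · intro R hR
    by_contra! hR2
    obtain ⟨z, hz⟩ := hz
    obtain ⟨x, hx⟩ := ha.linearCombination_surjective hn z
    obtain ⟨c, hc, hd⟩ := hR x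
    rw [hammingDist_comm, hammingDist_eq_hammingNorm] at hd
    obtain ⟨S, hS, hzS⟩ := (mem_spanOn_iff_exists_hammingNorm (h := h) z R).2
      ⟨-c + x, by rw [map_add, map_neg, LinearMap.mem_ker.1 hc, neg_zero, zero_add, hx], hd⟩
    exact hz S (by omega) hzS

/-- The syndrome of a coset. -/
noncomputable def syndrome (h : Fin n → Fin 3 → F) :
    ((Fin n → F) ⧸ columnCode h) →ₗ[F] (Fin 3 → F) :=
  (columnCode h).liftQ (Fintype.linearCombination F h) le_rfl

omit [DecidableEq F] in
theorem mkQ_eq_iff (V : (Fin n → F) ⧸ columnCode h) (x : Fin n → F) :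
    (columnCode h).mkQ x = V ↔ Fintype.linearCombination F h x = syndrome h V := by
  obtain ⟨y, rfl⟩ := (columnCode h).mkQ_surjective V
  simp only [Submodule.mkQ_apply, syndrome, Submodule.liftQ_apply]
  rw [Submodule.Quotient.eq, LinearMap.mem_ker, map_sub, sub_eq_zero]

omit [DecidableEq F] in
theorem IsArc.syndrome_bijective (ha : IsArc h) (hn : 3 ≤ n) :
    Function.Bijective (syndrome h) := by
  constructor
  · intro V W hVW
    obtain ⟨x, rfl⟩ := (columnCode h).mkQ_surjective V
    rw [mkQ_eq_iff, ← hVW, ← mkQ_eq_iff]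
  · intro z
    obtain ⟨x, hx⟩ := ha.linearCombination_surjective hn z
    exact ⟨(columnCode h).mkQ x, by rw [← (mkQ_eq_iff _ x).1 rfl, hx]⟩

theorem cosetWeight_le_iff (V : (Fin n → F) ⧸ columnCode h) (w : ℕ) :
    cosetWeight V ≤ w ↔ ∃ S : Finset (Fin n), #S ≤ w ∧ syndrome h V ∈ spanOn h S := by
  rw [mem_spanOn_iff_exists_hammingNorm]
  simp only [← mkQ_eq_iff]
  constructor
  · intro hw
    obtain ⟨x, hx⟩ := (columnCode h).mkQ_surjective V
    -- A coset is nonempty, so the infimum is an attained weight and not the default value 0.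
    obtain ⟨y, hy, hyw⟩ := Nat.sInf_mem
      (s := {w | ∃ x, (columnCode h).mkQ x = V ∧ hammingNorm x = w}) ⟨_, x, hx, rfl⟩
    exact ⟨y, hy, hyw.le.trans hw⟩
  · rintro ⟨x, hx, hw⟩
    have : cosetWeight V ≤ hammingNorm x := Nat.sInf_le ⟨x, hx, rfl⟩
    exact this.trans hw

variable [Fintype F]

theorem cosetWeightCount_eq (V : (Fin n → F) ⧸ columnCode h) (w : ℕ) :
    cosetWeightCount V w = weightCount h (syndrome h V) w := by
  rw [cosetWeightCount, weightCount, ← Set.ncard_coe_finset]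
  congr 1
  ext x
  simp only [mkQ_eq_iff, Set.mem_ofPred_eq, coe_filter, mem_univ, true_and]

theorem codeWeightCount_eq (w : ℕ) :
    codeWeightCount (columnCode h) w = weightCount h 0 w := by
  rw [codeWeightCount, weightCount, ← Set.ncard_coe_finset]
  congr 1
  ext x
  simp only [LinearMap.mem_ker, Set.mem_ofPred_eq, coe_filter, mem_univ, true_and]

omit [DecidableEq F] in
theorem IsArc.ncard_setOf_syndrome (ha : IsArc h) (hn : 3 ≤ n) (p : (Fin 3 → F) → Prop)
    [DecidablePred p] : {V | p (syndrome h V)}.ncard = #{z | p z} := by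
  have hb := ha.syndrome_bijective hn
  have : (({z | p z} : Finset (Fin 3 → F)) : Set (Fin 3 → F)) =
      syndrome h '' {V | p (syndrome h V)} := by
    ext z
    simp only [coe_filter, mem_univ, true_and, Set.mem_ofPred_eq, Set.mem_image]
    constructor
    · intro hz
      obtain ⟨V, rfl⟩ := hb.2 z
      exact ⟨V, hz, rfl⟩
    · rintro ⟨V, hV, rfl⟩
      exact hV
  rw [← Set.ncard_coe_finset, this, Set.ncard_image_of_injective _ hb.1]

theorem weightCount_eq_zero_of_le_one {z : Fin 3 → F}
    (hz : ∀ S : Finset (Fin n), #S ≤ 1 → z ∉ spanOn h S) {w : ℕ} (hw : w ≤ 1) :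
    weightCount h z w = 0 := by
  rw [weightCount, card_eq_zero, filter_eq_empty_iff]
  rintro x - ⟨hx, hxw⟩
  obtain ⟨S, hS, hzS⟩ := (mem_spanOn_iff_exists_hammingNorm (h := h) z 1).2 ⟨x, hx, by omega⟩
  exact hz S hS hzS

theorem IsArc.weightCount_zero_three (ha : IsArc h) (hn : 3 ≤ n) : weightCount h 0 3 = 0 := by
  rw [weightCount, card_eq_zero, filter_eq_empty_iff]
  rintro x - ⟨hx, hxw⟩
  have h0 : x ≠ 0 := by
    rintro rfl
    simp at hxw
  have := ha.four_le_hammingNorm hn (LinearMap.mem_ker.2 hx) h0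
  omega

omit [DecidableEq F] [Fintype F] in
theorem pairCount_eq_zero_iff (z : Fin 3 → F)
    (hz : ∀ S : Finset (Fin n), #S ≤ 1 → z ∉ spanOn h S) :
    pairCount h z = 0 ↔ ∀ S : Finset (Fin n), #S ≤ 2 → z ∉ spanOn h S := by
  classical
  rw [pairCount, card_eq_zero, filter_eq_empty_iff]
  simp only [mem_powersetCard, subset_univ, true_and]
  constructor
  · intro h1 S hS
    rcases hS.eq_or_lt with hS | hS
    · exact h1 hS
    · exact hz S (by omega)
  · intro h1 S hS
    exact h1 S hS.le

omit [DecidableEq F] [Fintype F] in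
theorem notMem_spanOn_of_card_le_one (hn : 0 < n) {z : Fin 3 → F}
    (hz : ¬ ∃ i, z ∈ spanOn h {i}) (S : Finset (Fin n)) (hS : #S ≤ 1) : z ∉ spanOn h S := by
  intro hzS
  obtain ⟨T, hST, hT⟩ := Finset.exists_superset_card_eq hS (by simpa using Nat.succ_le_of_lt hn)
  obtain ⟨i, rfl⟩ := card_eq_one.1 hT
  exact hz ⟨i, Submodule.span_mono (Set.image_mono (mod_cast hST)) hzS⟩

omit [Fintype F] in
-- The weight of a coset is the least number of columns whose span contains its syndrome, and it
-- never exceeds 3.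
theorem IsArc.cosetWeight_eq_iff (ha : IsArc h) (hn : 3 ≤ n)
    (V : (Fin n → F) ⧸ columnCode h) :
    (cosetWeight V = 2 ↔
      (¬ ∃ i, syndrome h V ∈ spanOn h {i}) ∧ pairCount h (syndrome h V) ≠ 0) ∧
    (cosetWeight V = 3 ↔
      (¬ ∃ i, syndrome h V ∈ spanOn h {i}) ∧ pairCount h (syndrome h V) = 0) := by
  have h3 : cosetWeight V ≤ 3 := (cosetWeight_le_iff V 3).2 (ha.exists_small_spanOn hn _)
  have h1 := cosetWeight_le_iff V 1
  have h2 := cosetWeight_le_iff V 2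
  by_cases hi : ∃ i, syndrome h V ∈ spanOn h {i}
  · have : cosetWeight V ≤ 1 := h1.2 (by
      obtain ⟨i, hi⟩ := hi
      exact ⟨{i}, by simp, hi⟩)
    simp only [hi, not_true, false_and, iff_false]
    omega
  · have hz := notMem_spanOn_of_card_le_one (by omega) hi
    have h1' : ¬ cosetWeight V ≤ 1 := by
      rw [h1]
      rintro ⟨S, hS, hzS⟩
      exact hz S hS hzS
    have h2' : pairCount h (syndrome h V) = 0 ↔ ¬ cosetWeight V ≤ 2 := by
      rw [pairCount_eq_zero_iff _ hz, h2]
      simp only [not_exists, not_and]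
    simp only [hi, not_false_eq_true, true_and, ne_eq, h2']
    omega

theorem IsArc.cosetWeightCount_of_three_le (ha : IsArc h) (hn : 3 ≤ n)
    {V : (Fin n → F) ⧸ columnCode h} (hV : ¬ ∃ i, syndrome h V ∈ spanOn h {i}) {w : ℕ}
    (hw : 3 ≤ w) :
    (cosetWeightCount V w : ℤ) = codeWeightCount (columnCode h) w -
      (-1) ^ w * (n.choose w : ℤ) * ((w - 1).choose 2 : ℤ) +
      (-1) ^ w * ((n - 2).choose (w - 2) : ℤ) * pairCount h (syndrome h V) := by
  have := ha.weightCount_of_three_le (by simpa using hn)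
    (notMem_spanOn_of_card_le_one (by omega) hV) hw
  rw [Fintype.card_fin] at this
  rwa [cosetWeightCount_eq, codeWeightCount_eq]

theorem IsArc.cosetWeightCount_of_le_two (ha : IsArc h) (hn : 3 ≤ n)
    {V : (Fin n → F) ⧸ columnCode h} (hV : ¬ ∃ i, syndrome h V ∈ spanOn h {i}) :
    cosetWeightCount V 0 = 0 ∧ cosetWeightCount V 1 = 0 ∧
      cosetWeightCount V 2 = pairCount h (syndrome h V) := by
  have hz := notMem_spanOn_of_card_le_one (by omega) hV
  simp only [cosetWeightCount_eq]
  exact ⟨weightCount_eq_zero_of_le_one hz (by omega), weightCount_eq_zero_of_le_one hz le_rfl,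
    ha.weightCount_two (by simpa using hn) hz⟩

end ArcCode

/-! ### The main theorem. -/

theorem mainTheorem12 {F : Type*} [Field F] [Fintype F] [DecidableEq F] (q : ℕ)
    (hqF : Fintype.card F = q) (hq : 7 ≤ q) :
    -- the points off the double shortened conic
    (∀ P₁ ∈ conic F, ∀ P₂ ∈ conic F, P₁ ≠ P₂ →
      ((conic F \ {P₁, P₂})ᶜ).ncard = q ^ 2 + 2 ∧
      ∃ A : ℕ → Set (ℙ F (Fin 3 → F)),
        (⋃ j ∈ Set.Icc 1 (numClasses q), A j) = (conic F \ {P₁, P₂})ᶜ ∧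
        (Set.Icc 1 (numClasses q)).PairwiseDisjoint A ∧
        ∀ j ∈ Set.Icc 1 (numClasses q),
          (A j).ncard = classSize q j ∧
          ∀ P ∈ A j, bisecantCount (conic F \ {P₁, P₂}) P = classBisecants q j) ∧
    -- the code obtained by removing the columns `s₁`, `s₂`; `e` orders the remaining columns
    (∀ (v : Option F → Fˣ) (s₁ s₂ : Option F), s₁ ≠ s₂ →
      ∀ (e : Fin (q - 1) ≃ {s : Option F // s ≠ s₁ ∧ s ≠ s₂})
        (H : Matrix (Fin 3) (Fin (q - 1)) F),
        H = (matrixH4 v).submatrix id (fun j => (e j : Option F)) →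
      ∀ C : Submodule F (Fin (q - 1) → F), C = codeOfParityCheck H →
        -- parameters of the code and the correspondence with the double shortened conic
        Module.finrank F C = q - 4 ∧ minDistance C = 4 ∧ coveringRadius C = 3 ∧
        ColumnsRepresent H (conic F \ {conicPoint s₁, conicPoint s₂}) ∧
        -- the classes of cosets of weight 2
        (∀ j ∈ Set.Ico 1 (numClasses q),
          {V : (Fin (q - 1) → F) ⧸ C | cosetWeight V = 2 ∧
            cosetWeightCount V 2 = classBisecants q j}.ncard = (q - 1) * classSize q j) ∧
        (∀ V : (Fin (q - 1) → F) ⧸ C, cosetWeight V = 2 →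
          (∃ j ∈ Set.Ico 1 (numClasses q), cosetWeightCount V 2 = classBisecants q j) ∧
          cosetWeightCount V 0 = 0 ∧ cosetWeightCount V 1 = 0 ∧
          ∀ w ∈ Set.Icc 3 (q - 1),
            (cosetWeightCount V w : ℤ) = codeWeightCount C w - omegaCoeff (q - 1) 4 w 0 +
              omegaCoeff (q - 1) 4 w 2 * cosetWeightCount V 2 ∧
            (cosetWeightCount V w : ℤ) = codeWeightCount C w - omegaCoeff (q - 1) 4 w 0 +
              (-1) ^ w * ((q - 3).choose (q - 1 - w) : ℤ) * cosetWeightCount V 2) ∧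
        -- the cosets of weight 3
        {V : (Fin (q - 1) → F) ⧸ C | cosetWeight V = 3}.ncard =
          (q - 1) * classSize q (numClasses q) ∧
        (∀ V : (Fin (q - 1) → F) ⧸ C, cosetWeight V = 3 →
          cosetWeightCount V 0 = 0 ∧ cosetWeightCount V 1 = 0 ∧ cosetWeightCount V 2 = 0 ∧
          cosetWeightCount V 3 = (q - 1).choose 3 ∧
          ∀ w ∈ Set.Icc 4 (q + 1),
            (cosetWeightCount V w : ℤ) = codeWeightCount C w -
              (-1) ^ w * ((q - 1).choose w : ℤ) * ((w - 1).choose 2 : ℤ))) := by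
  subst hqF
  refine ⟨?_, ?_⟩
  · rintro _ ⟨s₁, rfl⟩ _ ⟨s₂, rfl⟩ hne
    have hs : s₁ ≠ s₂ := fun h => hne (by rw [h])
    let h : {s : Option F // s ≠ s₁ ∧ s ≠ s₂} → Fin 3 → F := fun s => conicVec (s : Option F)
    have hcard := card_option_ne_ne (F := F) hs
    have hι : 3 ≤ Fintype.card {s : Option F // s ≠ s₁ ∧ s ≠ s₂} := by omega
    have hh : ∀ s, h s = (1 : Fˣ) • conicVec (Equiv.refl _ s : Option F) := fun s =>
      (one_smul _ _).symm
    have ha : IsArc h := by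
      have := isArc_conicVec.comp_smul (F := F) (Subtype.val_injective
        (p := fun s : Option F => s ≠ s₁ ∧ s ≠ s₂)) (fun _ => 1)
      simpa only [one_smul] using this
    have h0 := ha.ne_zero hι
    have hS := conic_diff_eq_range (Equiv.refl _) (fun _ => 1) hh h0
    obtain ⟨cls, c1, c2, c3, c4⟩ := exists_classification hq hs (Equiv.refl _) (fun _ => 1) hh
    refine ⟨?_, exists_partition_of_classification ha hι hq h0 hS c1 c2 c3 c4⟩
    rw [hS, ncard_compl_range_mk ha hι hcard h0]
  · intro v s₁ s₂ hs e H hH C hC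
    have hh : ∀ j, H.col j = v (e j) • conicVec (e j : Option F) := by
      intro j
      ext i
      rw [hH]
      simp [matrixH4, Units.smul_def, mul_comm, Matrix.col]
    obtain ⟨h, rfl⟩ : ∃ h, h = H.col := ⟨_, rfl⟩
    rw [codeOfParityCheck_eq_ker] at hC
    have hC' : C = columnCode H.col := hC
    clear hC
    subst hC'
    obtain ⟨cls, c1, c2, c3, c4⟩ := exists_classification hq hs e (fun j => v (e j)) hh
    have ha : IsArc H.col := by
      have := isArc_conicVec.comp_smul (Subtype.val_injective.comp e.injective)
        (fun j => v (e j))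
      exact (funext hh : H.col = _) ▸ this
    have hn : 3 ≤ Fintype.card F - 1 := by omega
    have hι : 3 ≤ Fintype.card (Fin (Fintype.card F - 1)) := by simpa using hn
    have h0 := ha.ne_zero hι
    have hS := conic_diff_eq_range e (fun j => v (e j)) hh h0
    have hnc : 1 ≤ numClasses (Fintype.card F) := by unfold numClasses; split_ifs <;> omega
    have hw2 : ∀ V : (Fin (Fintype.card F - 1) → F) ⧸ columnCode H.col, cosetWeight V = 2 ↔
        cls (syndrome H.col V) ∈ Set.Ico 1 (numClasses (Fintype.card F)) := by
      intro V
      have k1 := c1 (syndrome H.col V)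
      rw [(ha.cosetWeight_eq_iff hn V).1, ← c2, Set.mem_Ico, ← ne_eq (cls _),
        ← Nat.one_le_iff_ne_zero (n := cls _)]
      refine and_congr_right fun k2 => ?_
      rw [c3 _ (Nat.one_le_iff_ne_zero.1 k2), ne_eq, classBisecants_eq_zero_iff hq ⟨k2, k1⟩]
      omega
    have hw3 : ∀ V : (Fin (Fintype.card F - 1) → F) ⧸ columnCode H.col, cosetWeight V = 3 ↔
        cls (syndrome H.col V) = numClasses (Fintype.card F) := by
      intro V
      have k1 := c1 (syndrome H.col V)
      rw [(ha.cosetWeight_eq_iff hn V).2, ← c2, ← ne_eq, ← Nat.one_le_iff_ne_zero]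
      constructor
      · rintro ⟨k2, k3⟩
        rwa [c3 _ (Nat.one_le_iff_ne_zero.1 k2), classBisecants_eq_zero_iff hq ⟨k2, k1⟩] at k3
      · intro k3
        have k2 : 1 ≤ cls (syndrome H.col V) := by omega
        exact ⟨k2, by
          rw [c3 _ (Nat.one_le_iff_ne_zero.1 k2), classBisecants_eq_zero_iff hq ⟨k2, k1⟩, k3]⟩
    have hcount : ∀ V : (Fin (Fintype.card F - 1) → F) ⧸ columnCode H.col,
        cls (syndrome H.col V) ≠ 0 → cosetWeightCount V 0 = 0 ∧ cosetWeightCount V 1 = 0 ∧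
        cosetWeightCount V 2 = classBisecants (Fintype.card F) (cls (syndrome H.col V)) := by
      intro V hV
      have := ha.cosetWeightCount_of_le_two hn (mt (c2 _).2 hV)
      rwa [c3 _ hV] at this
    refine ⟨?_, ?_, ?_, ?_, ?_, ?_, ?_, ?_⟩
    · rw [ha.finrank_columnCode hn]
      omega
    · exact ha.minDistance_columnCode (by omega)
    · refine ha.coveringRadius_columnCode hn ?_
      -- The last class is nonempty; its vectors are the syndromes that two columns cannot reach.
      have hpos : 0 < (Finset.univ.filter fun z => cls z = numClasses (Fintype.card F)).card := by
        rw [c4 _ ⟨hnc, le_rfl⟩]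
        refine Nat.mul_pos (by omega) ?_
        unfold numClasses
        split_ifs with hF
        · rw [(classSize_odd hF).2.2.2]; norm_num
        · rw [(classSize_even hF).2.2]; norm_num
      obtain ⟨z, hz⟩ := Finset.card_pos.1 hpos
      have hz' : cls z = numClasses (Fintype.card F) := (Finset.mem_filter.1 hz).2
      have hz0 : cls z ≠ 0 := by omega
      refine ⟨z, (pairCount_eq_zero_iff z
        (notMem_spanOn_of_card_le_one (by omega) (mt (c2 z).2 hz0))).1 ?_⟩
      rw [c3 z hz0, classBisecants_eq_zero_iff hq ⟨by omega, c1 z⟩, hz']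
    · exact ⟨h0, ha.injective_mk hι h0, hS.symm⟩
    · intro j hj
      have hj' : j ∈ Set.Icc 1 (numClasses (Fintype.card F)) := ⟨hj.1, hj.2.le⟩
      rw [← c4 j hj', ← ha.ncard_setOf_syndrome hn]
      congr 1
      ext V
      simp only [Set.mem_ofPred_eq, hw2]
      constructor
      · rintro ⟨k1, k2⟩
        rw [(hcount V (Nat.one_le_iff_ne_zero.1 k1.1)).2.2] at k2
        exact classBisecants_injOn hq ⟨k1.1, k1.2.le⟩ hj' k2
      · rintro rfl
        exact ⟨hj, (hcount V (Nat.one_le_iff_ne_zero.1 hj.1)).2.2⟩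
    · intro V hV
      rw [hw2] at hV
      have hV0 := Nat.one_le_iff_ne_zero.1 hV.1
      obtain ⟨k0, k1, k2⟩ := hcount V hV0
      refine ⟨⟨_, hV, k2⟩, k0, k1, fun w hw => ?_⟩
      have key := ha.cosetWeightCount_of_three_le hn (mt (c2 _).2 hV0) hw.1
      rw [c3 _ hV0, ← k2] at key
      have hsign : (-1 : ℤ) ^ (w + 4) = (-1) ^ w := by rw [pow_add]; norm_num
      -- Symmetry of binomial coefficients, as (q−3) − (w−2) = q − 1 − w. The other factor C(w−3, 0)
      -- of Ω_w^{(2)} is 1.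
      have hchoose : (Fintype.card F - 3).choose (Fintype.card F - 1 - w) =
          (Fintype.card F - 1 - 2).choose (w - 2) := by
        have hw1 := hw.1
        have hw2 := hw.2
        rw [show Fintype.card F - 1 - 2 = Fintype.card F - 3 by omega,
          ← Nat.choose_symm (by omega : w - 2 ≤ Fintype.card F - 3)]
        congr 1
        omega
      rw [key, omegaCoeff, omegaCoeff, hsign, hchoose]
      simp
    · rw [← c4 _ ⟨hnc, le_rfl⟩, ← ha.ncard_setOf_syndrome hn]
      congr 1
      ext V
      simp only [Set.mem_ofPred_eq, hw3]
    · intro V hV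
      rw [hw3] at hV
      have hV0 : cls (syndrome H.col V) ≠ 0 := by omega
      obtain ⟨k0, k1, k2⟩ := hcount V hV0
      have hb : classBisecants (Fintype.card F) (cls (syndrome H.col V)) = 0 := by
        rw [classBisecants_eq_zero_iff hq ⟨by omega, c1 _⟩, hV]
      rw [hb] at k2
      have key : ∀ w, 3 ≤ w → (cosetWeightCount V w : ℤ) = codeWeightCount (columnCode H.col) w -
          (-1) ^ w * ((Fintype.card F - 1).choose w : ℤ) * ((w - 1).choose 2 : ℤ) := by
        intro w hw
        have := ha.cosetWeightCount_of_three_le hn (mt (c2 _).2 hV0) hw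
        rw [c3 _ hV0, hb] at this
        simpa using this
      refine ⟨k0, k1, k2, ?_, fun w hw => key w (by have := hw.1; omega)⟩
      -- There are no codewords of weight 3, so only −(−1)³ C(q−1, 3) C(2, 2) remains.
      have h3 := key 3 le_rfl
      rw [codeWeightCount_eq, ha.weightCount_zero_three hn] at h3
      norm_num at h3
      exact_mod_cast h3
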